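/- All vector spaces are over $\mathbb C$. Let $L$ be the Virasoro-like algebra: it has basis $D(\mathbf r)$ ($\mathbf r\in\mathbb Z^2\setminus\{0\}$), $c_1,c_2$, where $c_1,c_2$ are central, $D(\mathbf 0):=0$, and $$[D(\mathbf m),D(\mathbf n)]=-\det(\mathbf m,\mathbf n)\,D(\mathbf m+\mathbf n)+\delta_{\mathbf m+\mathbf n,\mathbf 0}\,h(\mathbf m),\qquad \det(\mathbf m,\mathbf n)=m_1n_2-m_2n_1,\quad h(\mathbf m)=m_1c_1+m_2c_2 .$$ Fix a $\mathbb Z$-basis $\mathbf b_1,\mathbf b_2$ of $\mathbb Z^2$ and grade $L=\bigoplus_{j\in\mathbb Z}L_j$ by $L_j=\langle D(j\mathbf b_1+m\mathbf b_2)\mid m\in\mathbb Z\rangle\oplus\delta_{j,0}\langle c_1,c_2\rangle$. A $\mathbb Z$-graded $L$-module is an $L$-module $V=\bigoplus_{n\in\mathbb Z}V_n$ with $L_mV_n\subseteq V_{m+n}$ for all $m,n$. It is in $\mathcal O_{\mathbb Z}$ if all $V_n$ are finite-dimensional and $V$ is irreducible, i.e. $V\ne0$ and its only graded submodules are $0$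 and $V$. It is uniformly bounded if there is $N\in\mathbb N$ with $\dim V_n\le N$ for all $n$. For a linear function $\psi:L_0\to\mathbb C$ with $\psi(h(\mathbf b_2))=0$, let $\overline V^{\pm}(\psi)=U(L)\otimes_{U(L_0+L_\pm)}\mathbb Cv_0$, where $L_+=\bigoplus_{j>0}L_j$, $L_-=\bigoplus_{j<0}L_j$, $L_{\pm}v_0=0$, and $xv_0=\psi(x)v_0$ for $x\in L_0$, graded with $v_0$ in degree $0$; let $\widehat V^{\pm}(\psi)$ be its quotient by its largest proper graded submodule. Call $\psi$ an exp-polynomial function over $L_0$ if $\psi\neq0$, $\psi(h(\mathbf b_2))=0$, and there are polynomials $P_1,\dots,P_r\in\mathbb C[x]$ and $\alpha_1,\dots,\alpha_r\in\mathbb C\setminus\{0\}$ with $$\psi(D(k\mathbf b_2))=\frac{P_1(k)\alpha_1^k+\cdots+P_r(k)\alpha_r^k}{k}\quad(k\in\mathbb Z\setminus\{0\}),\qquad \psi(h(\mathbf b_1))=-\det(\mathbf b_1,\mathbf b_2)\,(P_1(0)+\cdots+P_r(0)).$$ **Theorem 3.7.** Let $V$ be a $\mathbb Z$-graded $L$-module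 in $\mathcal O_{\mathbb Z}$. Then one and only one of the following cases holds: 1. $V$ is uniformly bounded; 2. $V\simeq\widehat V^{+}(\psi)$ for some exp-polynomial function $\psi$ over $L_0$; 3. $V\simeq\widehat V^{-}(\psi)$ for some exp-polynomial function $\psi$ over $L_0$. In (2) and (3) the isomorphism can be taken homogeneous (it carries the grading of $V$ to that of $\widehat V^\pm(\psi)$ up to a shift of degrees), and the exclusivity holds for arbitrary isomorphisms of $L$-modules. Moreover, for every exp-polynomial function $\psi$ over $L_0$ one has $\dim\widehat V^{+}(\psi)_{-n}\ge n$ for all $n\ge1$, so that $\widehat V^{+}(\psi)$ is not uniformly bounded. -/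

import Mathlib

/-- The underlying space of the Virasoro-like algebra `L`: it has the basis
`D(r)` (`r ∈ ℤ², r ≠ 0`), `c₁`, `c₂`. -/
def VirasoroLike : Type := ({r : ℤ × ℤ // r ≠ 0} →₀ ℂ) × ℂ × ℂ

namespace VirasoroLike

noncomputable section

instance : AddCommGroup VirasoroLike :=
  inferInstanceAs (AddCommGroup (({r : ℤ × ℤ // r ≠ 0} →₀ ℂ) × ℂ × ℂ))

instance : Module ℂ VirasoroLike :=
  inferInstanceAs (Module ℂ (({r : ℤ × ℤ // r ≠ 0} →₀ ℂ) × ℂ × ℂ))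

/-- The inclusion of the span of the `D(r)`. -/
def dIncl : ({r : ℤ × ℤ // r ≠ 0} →₀ ℂ) →ₗ[ℂ] VirasoroLike := LinearMap.inl ℂ _ (ℂ × ℂ)

/-- The inclusion `(x, y) ↦ x c₁ + y c₂`. -/
def cIncl : (ℂ × ℂ) →ₗ[ℂ] VirasoroLike := LinearMap.inr ℂ _ (ℂ × ℂ)

/-- The element `D(r)`, with `D(0) = 0`. -/
def D (r : ℤ × ℤ) : VirasoroLike :=
  if hr : r ≠ 0 then dIncl (Finsupp.single ⟨r, hr⟩ 1) else 0

/-- The element `h(m) = m₁ c₁ + m₂ c₂`. In particular `c₁ = h (1, 0)` and `c₂ = h (0, 1)`. -/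
def h (m : ℤ × ℤ) : VirasoroLike := cIncl ((m.1 : ℂ), (m.2 : ℂ))

/-- `det(m, n) = m₁ n₂ - m₂ n₁`. -/
def det (m n : ℤ × ℤ) : ℤ := m.1 * n.2 - m.2 * n.1

/-- The bracket `[D(m), D(n)] = -det(m, n) D(m + n) + δ_{m+n,0} h(m)`. -/
def bracketD (m n : ℤ × ℤ) : VirasoroLike :=
  (-(det m n : ℂ)) • D (m + n) + if m + n = 0 then h m else 0

/-- The `D`-part of an element. -/
def dPart : VirasoroLike →ₗ[ℂ] ({r : ℤ × ℤ // r ≠ 0} →₀ ℂ) := LinearMap.fst ℂ _ (ℂ × ℂ)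

/-- The bilinear extension of `bracketD`, vanishing when an argument lies in `⟨c₁, c₂⟩`. -/
def bracketL : VirasoroLike →ₗ[ℂ] VirasoroLike →ₗ[ℂ] VirasoroLike :=
  (Finsupp.linearCombination ℂ
    (fun m : {r : ℤ × ℤ // r ≠ 0} => Finsupp.linearCombination ℂ
      (fun n : {r : ℤ × ℤ // r ≠ 0} => bracketD m.1 n.1))).compl₁₂ dPart dPart

instance : Bracket VirasoroLike VirasoroLike := ⟨fun x y => bracketL x y⟩

theorem bracket_def (x y : VirasoroLike) : ⁅x, y⁆ = bracketL x y := rfl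

@[simp] theorem D_zero : D 0 = 0 := by simp [D]

@[simp] theorem h_zero : h 0 = 0 := by
  have e : (((0 : ℤ × ℤ).1 : ℂ), ((0 : ℤ × ℤ).2 : ℂ)) = 0 := by simp
  rw [h, e, map_zero]

theorem h_neg (m : ℤ × ℤ) : h (-m) = -h m := by
  rw [h, h, ← map_neg]; congr 1; simp

theorem h_add (m n : ℤ × ℤ) : h (m + n) = h m + h n := by
  rw [h, h, h, ← map_add]; congr 1; simp

theorem dPart_dIncl (f : {r : ℤ × ℤ // r ≠ 0} →₀ ℂ) : dPart (dIncl f) = f := rfl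

theorem dPart_cIncl (z : ℂ × ℂ) : dPart (cIncl z) = 0 := rfl

theorem D_coe (r : {r : ℤ × ℤ // r ≠ 0}) : D r.1 = dIncl (Finsupp.single r 1) := by
  rw [D, dif_pos r.2]

theorem dPart_D (r : {r : ℤ × ℤ // r ≠ 0}) : dPart (D r.1) = Finsupp.single r 1 := by
  rw [D_coe, dPart_dIncl]

@[simp] theorem dPart_h (m : ℤ × ℤ) : dPart (h m) = 0 := rfl

theorem D_lie_D (m n : ℤ × ℤ) :
    ⁅D m, D n⁆ = (-(det m n : ℂ)) • D (m + n) + if m + n = 0 then h m else 0 := by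
  by_cases hm : m = 0
  · subst hm
    simp [bracket_def, bracketL, det]
  by_cases hn : n = 0
  · subst hn
    simp [bracket_def, bracketL, det, hm]
  have h1 := dPart_D ⟨m, hm⟩
  have h2 := dPart_D ⟨n, hn⟩
  simp only at h1 h2
  simp [bracket_def, bracketL, h1, h2, bracketD]

theorem h_lie (m : ℤ × ℤ) (x : VirasoroLike) : ⁅h m, x⁆ = 0 := by
  simp [bracket_def, bracketL]

theorem lie_h (m : ℤ × ℤ) (x : VirasoroLike) : ⁅x, h m⁆ = 0 := by
  simp [bracket_def, bracketL]

/-- Every element is a linear combination of the `D(r)` and of `c₁, c₂`. -/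
theorem induction_on {p : VirasoroLike → Prop} (x : VirasoroLike)
    (hD : ∀ r, p (D r)) (hh : ∀ m, p (h m)) (hadd : ∀ x y, p x → p y → p (x + y))
    (hsmul : ∀ (a : ℂ) x, p x → p (a • x)) : p x := by
  have hf : ∀ f, p (dIncl f) := by
    intro f
    induction f using Finsupp.induction_linear with
    | zero => rw [map_zero, ← D_zero]; exact hD 0
    | add f g hf hg => rw [map_add]; exact hadd _ _ hf hg
    | single r c =>
      have e : dIncl (Finsupp.single r c) = c • D r.1 := by
        rw [D_coe, ← map_smul, Finsupp.smul_single, smul_eq_mul, mul_one]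
      rw [e]; exact hsmul _ _ (hD _)
  have hc : ∀ z, p (cIncl z) := by
    intro z
    have e : cIncl z = z.1 • h (1, 0) + z.2 • h (0, 1) := by
      rw [h, h, ← map_smul, ← map_smul, ← map_add]; congr 1; ext <;> simp
    rw [e]; exact hadd _ _ (hsmul _ _ (hh _)) (hsmul _ _ (hh _))
  have e : x = dIncl x.1 + cIncl x.2 := by
    change ({r : ℤ × ℤ // r ≠ 0} →₀ ℂ) × ℂ × ℂ at x
    have e : x = LinearMap.inl ℂ _ (ℂ × ℂ) x.1 + LinearMap.inr ℂ _ (ℂ × ℂ) x.2 := by simp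
    exact e
  rw [e]; exact hadd _ _ (hf _) (hc _)

theorem lie_skew_aux (x y : VirasoroLike) : bracketL x y = -bracketL y x := by
  refine induction_on (p := fun x => bracketL x y = -bracketL y x) x (fun m => ?_) (fun m => ?_) (fun a b ha hb => ?_) (fun c a ha => ?_)
  · refine induction_on (p := fun y => bracketL (D m) y = -bracketL y (D m)) y (fun n => ?_) (fun n => ?_) (fun a b ha hb => ?_) (fun c a ha => ?_)
    · rw [← bracket_def, ← bracket_def, D_lie_D, D_lie_D, add_comm n m]
      have hd : det n m = -det m n := by simp [det]; ring
      by_cases hmn : m + n = 0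
      · obtain rfl : n = -m := by rw [eq_neg_iff_add_eq_zero, add_comm]; exact hmn
        simp [h_neg]
      · simp [hmn, hd]
    · rw [← bracket_def, ← bracket_def, h_lie, lie_h, neg_zero]
    · simp [ha, hb, add_comm]
    · simp [ha]
  · rw [← bracket_def, ← bracket_def, h_lie, lie_h, neg_zero]
  · simp [ha, hb, add_comm]
  · simp [ha]

theorem jacobi_aux (x y z : VirasoroLike) :
    bracketL x (bracketL y z) = bracketL (bracketL x y) z + bracketL y (bracketL x z) := by
  refine induction_on (p := fun x =>
      bracketL x (bracketL y z) = bracketL (bracketL x y) z + bracketL y (bracketL x z)) x (fun m => ?_) (fun m => ?_) (fun a b ha hb => ?_) (fun c a ha => ?_)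
  · refine induction_on (p := fun y =>
      bracketL (D m) (bracketL y z) = bracketL (bracketL (D m) y) z + bracketL y (bracketL (D m) z)) y (fun n => ?_) (fun n => ?_) (fun a b ha hb => ?_) (fun c a ha => ?_)
    · refine induction_on (p := fun z =>
      bracketL (D m) (bracketL (D n) z) = bracketL (bracketL (D m) (D n)) z + bracketL (D n) (bracketL (D m) z)) z (fun p => ?_) (fun p => ?_) (fun a b ha hb => ?_) (fun c a ha => ?_)
      · have key : ∀ a b c : ℤ × ℤ, bracketL (D a) (bracketL (D b) (D c)) =
            ((det b c * det a (b + c) : ℤ) : ℂ) • D (a + b + c) +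
              (if a + b + c = 0 then (-(det b c : ℂ)) • h a else 0) := by
          intro a b c
          have e1 : bracketL (D b) (D c) = _ := D_lie_D b c
          have e2 : bracketL (D a) (D (b + c)) = _ := D_lie_D a (b + c)
          have e3 : ∀ m, bracketL (D a) (h m) = 0 := fun m => lie_h m (D a)
          rw [e1, map_add, map_smul, e2, ← add_assoc]
          split_ifs <;> simp [e3, smul_smul]
        rw [lie_skew_aux (bracketL (D m) (D n)), key, key, key]
        have e4 : p + m + n = m + n + p := by abel
        have e5 : n + m + p = m + n + p := by abel
        rw [e4, e5]
        by_cases hs : m + n + p = 0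
        · obtain rfl : p = -(m + n) := by rw [eq_neg_iff_add_eq_zero, add_comm]; exact hs
          simp only [hs, if_true, D_zero, smul_zero, zero_add, h_neg, h_add, det]
          simp only [smul_neg, neg_smul, smul_add, Prod.fst_neg, Prod.snd_neg, Prod.fst_add,
            Prod.snd_add]
          push_cast
          module
        · simp only [hs, if_false, add_zero, ← neg_smul, ← add_smul]
          congr 1
          simp only [det, Prod.fst_add, Prod.snd_add]
          push_cast
          ring
      · have e3 : ∀ m x, bracketL x (h m) = 0 := fun m x => lie_h m x
        simp [e3]
      · simp only [map_add, ha, hb]; abel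
      · simp only [map_smul, ha, smul_add]
    · have e3 : ∀ m x, bracketL x (h m) = 0 := fun m x => lie_h m x
      have e4 : ∀ m x, bracketL (h m) x = 0 := fun m x => h_lie m x
      simp [e3, e4]
    · simp only [map_add, LinearMap.add_apply, ha, hb]; abel
    · simp only [map_smul, LinearMap.smul_apply, ha, smul_add]
  · have e4 : ∀ m x, bracketL (h m) x = 0 := fun m x => h_lie m x
    simp [e4]
  · simp only [map_add, LinearMap.add_apply, ha, hb]; abel
  · simp only [map_smul, LinearMap.smul_apply, ha, smul_add]

instance : LieRing VirasoroLike where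
  add_lie x y z := by simp [bracket_def]
  lie_add x y z := by simp [bracket_def]
  lie_self x := by
    rw [bracket_def]
    have h1 := lie_skew_aux x x
    have h2 : (2 : ℂ) • bracketL x x = 0 := by
      rw [two_smul]; nth_rewrite 2 [h1]; exact add_neg_cancel _
    exact (smul_eq_zero.mp h2).resolve_left two_ne_zero
  leibniz_lie x y z := by
    simp only [bracket_def]
    exact jacobi_aux x y z

instance : LieAlgebra ℂ VirasoroLike where
  lie_smul a x y := by simp [bracket_def]

/-! ### The `ℤ`-grading attached to a `ℤ`-basis of `Γ = ℤ²` -/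

section Grading

/-- The degree `j` subspace `L_j = ⟨D(j b₁ + m b₂) | m ∈ ℤ⟩ ⊕ δ_{j,0} ⟨c₁, c₂⟩`, for a
`ℤ`-basis `b₁ = b 0`, `b₂ = b 1` of `ℤ²`. -/
def gr (b : Module.Basis (Fin 2) ℤ (ℤ × ℤ)) (j : ℤ) : Submodule ℂ VirasoroLike :=
  Submodule.span ℂ (Set.range fun m : ℤ => D (j • b 0 + m • b 1)) ⊔
    (if j = 0 then Submodule.span ℂ {h (1, 0), h (0, 1)} else ⊥)

theorem D_mem_gr_zero (b : Module.Basis (Fin 2) ℤ (ℤ × ℤ)) (k : ℤ) : D (k • b 1) ∈ gr b 0 :=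
  Submodule.mem_sup_left (Submodule.subset_span ⟨k, by simp⟩)

theorem h_mem_gr_zero (b : Module.Basis (Fin 2) ℤ (ℤ × ℤ)) (m : ℤ × ℤ) : h m ∈ gr b 0 := by
  refine Submodule.mem_sup_right ?_
  rw [if_pos rfl, Submodule.mem_span_pair]
  refine ⟨m.1, m.2, ?_⟩
  rw [h, h, h, ← map_smul, ← map_smul, ← map_add]; congr 1; ext <;> simp

/-- `D(k b₂)` as an element of `L_0`. -/
def D₀ (b : Module.Basis (Fin 2) ℤ (ℤ × ℤ)) (k : ℤ) : gr b 0 := ⟨D (k • b 1), D_mem_gr_zero b k⟩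

/-- `h(m)` as an element of `L_0`. -/
def h₀ (b : Module.Basis (Fin 2) ℤ (ℤ × ℤ)) (m : ℤ × ℤ) : gr b 0 := ⟨h m, h_mem_gr_zero b m⟩

/-- `ψ` is an exp-polynomial function over `L_0`: it is a nonzero linear function with
`ψ(h(b₂)) = 0`, and there are polynomials `P₁, …, P_r` over `ℂ` and nonzero
`α₁, …, α_r ∈ ℂ` with `ψ(D(k b₂)) = (∑ P_i(k) α_i ^ k) / k` for all `k ≠ 0` and
`ψ(h(b₁)) = -det(b₁, b₂) ∑ P_i(0)`. -/
def IsExpPolynomial (b : Module.Basis (Fin 2) ℤ (ℤ × ℤ)) (ψ : gr b 0 →ₗ[ℂ] ℂ) : Prop :=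
  ψ ≠ 0 ∧ ψ (h₀ b (b 1)) = 0 ∧
    ∃ (r : ℕ) (P : Fin r → Polynomial ℂ) (α : Fin r → ℂ), (∀ i, α i ≠ 0) ∧
      (∀ k : ℤ, k ≠ 0 → ψ (D₀ b k) = (∑ i, (P i).eval (k : ℂ) * α i ^ k) / (k : ℂ)) ∧
      ψ (h₀ b (b 0)) = -(det (b 0) (b 1) : ℂ) * ∑ i, (P i).coeff 0

end Grading

/-! ### Graded modules -/

section GradedModules

universe u

variable {V : Type u} [AddCommGroup V] [Module ℂ V]

/-- The dimensions of all homogeneous subspaces are bounded by one natural number. -/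
def UniformlyBounded (𝒱 : ℤ → Submodule ℂ V) : Prop :=
  ∃ N : ℕ, ∀ n : ℤ, Module.rank ℂ (𝒱 n) ≤ N

/-- A subspace is graded when it is spanned by its homogeneous elements. -/
def IsGradedSubspace (𝒱 : ℤ → Submodule ℂ V) (W : Submodule ℂ V) : Prop :=
  W ≤ ⨆ n, W ⊓ 𝒱 n

/-- `V = ⨁ 𝒱 n` is a `ℤ`-graded `L`-module: `L_m · V_n ⊆ V_{m+n}`. -/
structure IsGradedModule (b : Module.Basis (Fin 2) ℤ (ℤ × ℤ))
    [LieRingModule VirasoroLike V] (𝒱 : ℤ → Submodule ℂ V) : Prop where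
  isInternal : DirectSum.IsInternal 𝒱
  lie_mem : ∀ m n : ℤ, ∀ x ∈ gr b m, ∀ v ∈ 𝒱 n, ⁅x, v⁆ ∈ 𝒱 (m + n)

/-- The class `𝒪_ℤ`: graded modules with finite dimensional homogeneous subspaces that are
irreducible, i.e. nonzero and without graded submodules other than `0` and `V`.
(A graded module that is simple as a plain `L`-module is irreducible in this sense.) -/
structure InO (b : Module.Basis (Fin 2) ℤ (ℤ × ℤ))
    [LieRingModule VirasoroLike V] [LieModule ℂ VirasoroLike V]
    (𝒱 : ℤ → Submodule ℂ V) : Prop extends IsGradedModule b 𝒱 where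
  finite : ∀ n, FiniteDimensional ℂ (𝒱 n)
  nontrivial : Nontrivial V
  irreducible : ∀ W : LieSubmodule ℂ VirasoroLike V,
    IsGradedSubspace 𝒱 W.toSubmodule → W = ⊥ ∨ W = ⊤

end GradedModules

/-! ### The highest and lowest weight modules -/

section Induced

/-- The universal enveloping algebra `U(L)`. -/
abbrev U : Type := UniversalEnvelopingAlgebra ℂ VirasoroLike

/-- The canonical map `L → U(L)`. -/
abbrev ι : VirasoroLike → U := UniversalEnvelopingAlgebra.ι ℂ

theorem ι_lie (x y : VirasoroLike) : ι ⁅x, y⁆ = ι x * ι y - ι y * ι x := by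
  let _ : LieRing U := LieRing.ofAssociativeRing
  exact LieHom.map_lie (UniversalEnvelopingAlgebra.ι ℂ) x y

/-- The degree `n` part of `U(L)`: the span of the products `x₁ ⋯ x_k` with `x_i ∈ L_{j_i}` and
`j₁ + ⋯ + j_k = n`. -/
def grU (b : Module.Basis (Fin 2) ℤ (ℤ × ℤ)) (n : ℤ) : Submodule ℂ U :=
  Submodule.span ℂ {u | ∃ l : List (ℤ × VirasoroLike), (∀ p ∈ l, p.2 ∈ gr b p.1) ∧
    (l.map Prod.fst).sum = n ∧ u = (l.map fun p => ι p.2).prod}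

variable (b : Module.Basis (Fin 2) ℤ (ℤ × ℤ)) (s : ℤˣ) (ψ : gr b 0 →ₗ[ℂ] ℂ)

/-- The left ideal of `U(L)` generated by `x - ψ(x)` (`x ∈ L_0`) and by the `L_j` with `j > 0`
if `s = 1`, with `j < 0` if `s = -1`. -/
def indIdeal : Submodule U U :=
  Submodule.span U
    ({u | ∃ x : gr b 0, u = ι x - algebraMap ℂ U (ψ x)} ∪
      {u | ∃ j : ℤ, 0 < (s : ℤ) * j ∧ ∃ x ∈ gr b j, u = ι x})

/-- The induced module `U(L) ⊗_{U(L_0 + L_±)} ℂ v₀`, where `x v₀ = ψ(x) v₀` for `x ∈ L_0` and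
`L_± v₀ = 0`, presented as the cyclic module `U(L) / indIdeal` with generator `v₀ = 1`.
The sign is `+` for `s = 1` and `-` for `s = -1`. -/
abbrev VBar : Type := U ⧸ indIdeal b s ψ

/-- The grading of the induced module, with `v₀` in degree `0`. -/
def grVBar (n : ℤ) : Submodule ℂ (VBar b s ψ) :=
  (grU b n).map ((indIdeal b s ψ).mkQ.restrictScalars ℂ)

/-- The largest proper graded submodule `J`: the sum of all proper graded submodules. -/
def maxSub : Submodule U (VBar b s ψ) :=
  sSup {W | W ≠ ⊤ ∧ IsGradedSubspace (grVBar b s ψ) (W.restrictScalars ℂ)}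

/-- The irreducible graded module `VBar / J`: the highest weight module `V̂⁺(ψ)` for `s = 1` and
the lowest weight module `V̂⁻(ψ)` for `s = -1`. -/
def VHat : Type := VBar b s ψ ⧸ maxSub b s ψ

instance : AddCommGroup (VHat b s ψ) :=
  inferInstanceAs (AddCommGroup (VBar b s ψ ⧸ maxSub b s ψ))

instance : Module U (VHat b s ψ) :=
  inferInstanceAs (Module U (VBar b s ψ ⧸ maxSub b s ψ))

instance : Module ℂ (VHat b s ψ) :=
  inferInstanceAs (Module ℂ (VBar b s ψ ⧸ maxSub b s ψ))

instance : IsScalarTower ℂ U (VHat b s ψ) :=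
  inferInstanceAs (IsScalarTower ℂ U (VBar b s ψ ⧸ maxSub b s ψ))

/-- `L` acts on `V̂` through `L → U(L)`. -/
instance : LieRingModule VirasoroLike (VHat b s ψ) where
  bracket x v := ι x • v
  add_lie x y v := by
    show ι (x + y) • v = ι x • v + ι y • v
    rw [← add_smul]; congr 1; exact map_add _ x y
  lie_add x v w := smul_add _ _ _
  leibniz_lie x y v := by
    show ι x • ι y • v = ι ⁅x, y⁆ • v + ι y • ι x • v
    rw [ι_lie, sub_smul, mul_smul, mul_smul]; abel

instance : LieModule ℂ VirasoroLike (VHat b s ψ) where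
  smul_lie a x v := by
    show ι (a • x) • v = a • ι x • v
    rw [← smul_assoc]; congr 1; exact map_smul _ a x
  lie_smul a x v := by
    show ι x • a • v = a • ι x • v
    rw [← algebraMap_smul U a v, ← algebraMap_smul U a (ι x • v), ← mul_smul, ← mul_smul,
      Algebra.commutes]

/-- The grading of `V̂`, with the class of `v₀` in degree `0`. -/
def grVHat (n : ℤ) : Submodule ℂ (VHat b s ψ) :=
  (grVBar b s ψ n).map ((maxSub b s ψ).mkQ.restrictScalars ℂ)

universe u

/-- An isomorphism of `L`-modules `V ≃ V̂` that is homogeneous, i.e. carries the grading of `V`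
to the grading of `V̂` up to a shift of degrees. -/
def HomogeneousIso {V : Type u} [AddCommGroup V] [Module ℂ V] [LieRingModule VirasoroLike V]
    (𝒱 : ℤ → Submodule ℂ V) : Prop :=
  ∃ (e : V ≃ₗ⁅ℂ, VirasoroLike⁆ VHat b s ψ) (d : ℤ), ∀ n : ℤ,
    (𝒱 n).map (e : V →ₗ[ℂ] VHat b s ψ) = grVHat b s ψ (n + d)

end Induced

end

end VirasoroLike

/-!
Write `D(j, m)` for `D(j b₁ + m b₂)` and suppose that the dimensions of the `V_n` are unbounded.

*Boundedness on one side.* Some `V_{-K}`, `K ≠ 0`, is larger than `V_{-1}`, `V_0` and `V_1` together.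
For `K > 0` it contains a nonzero vector killed by `D(K, 1)` and `D(K + 1, 1)`, hence by `D(r)` for
all `r` in the open cone spanned by two vectors that form a basis of `ℤ²`. The vectors killed by a
deep enough part of this cone form a submodule, which is everything by irreducibility; as the `V_k`
are finite dimensional and `L_0` preserves them, each `V_k` is killed by `L_j` for `j` large
(`IsGradedIrreducible.exists_killed`). Since `D(-1, 0)` and the `L_j` with `j` large generate `L`, the
operator `D(-1, 0)` is injective. As it commutes with the `D(j, 0)`, the bound on `j` does not depend
on `k`. Commutators then show that the `D(0, m)` kill `V_k` for `k` large, and so does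
`[D(0, m), D(-1, -m)]`, a multiple of `D(-1, 0)`; hence `V_k = 0` for `k` large
(`IsGradedIrreducible.eq_bot_of_killed`). For `K < 0` the same holds with `b₁` replaced by `-b₁`, and
`V_k = 0` for `-k` large.

*Recognition.* On the extreme nonzero degree `L_0` has a common eigenvector (`exists_eigenvector`),
which is a highest or lowest weight vector of some weight `ψ`; an irreducible graded module with
such a vector is `V̂^±(ψ)` up to a shift (`InO.homogeneousIso`). Let `f(k) = k ψ(D(0, k))`, with `f(0)`
determined by `ψ(h(b₁))`. Then `D(1, r) D(-1, m) v` is, up to a nonzero constant, `f(r + m) v`. The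
vectors `D(-1, m) v` lie in a finite dimensional space, so `f` satisfies a two-sided linear
recurrence and is exp-polynomial (`IsExtremal.isExpPolynomial`, `mem_expPoly_of_recurrence`).

*Growth.* If `ψ ≠ 0`, choose `k` with `f(k) ≠ 0`. As `D(n, 0)` commutes with `D(-1, 0)` for `n ≥ 2` and
maps `D(-n, k) v` to a nonzero multiple of `v`, the vector `D(-n, k) v` is not in the image of the
injective operator `D(-1, 0)`, so the dimension grows by at least one in each step
(`IsExtremal.exists_linearIndependent`). That `V̂⁺(ψ)` is not zero does not need the theorem of
Poincaré, Birkhoff and Witt: `L` acts on `U(L_-)`, with `L_-` acting by left multiplication and `1`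
being a highest weight vector, and the augmentation of `U(L_-)` separates `1` from the vectors of
negative degree (`vBar_not_mem_lowVBar`).

*Exclusivity.* Under an arbitrary isomorphism with `V̂^±(ψ)`, the homogeneous components of the
extremal vector are again extremal (`IsExtremal.exists_homogeneous`). So in case (2) the module
vanishes in high degrees, in case (3) in low degrees, and by the growth estimate neither is
uniformly bounded; in both cases at once only finitely many degrees would be nonzero.
-/

namespace VirasoroLike

noncomputable section

/-! ### Coordinates with respect to the basis -/

/-- The element `D(j b₁ + m b₂)`, of degree `j`. -/
def E (b : Module.Basis (Fin 2) ℤ (ℤ × ℤ)) (j m : ℤ) : VirasoroLike := D (j • b 0 + m • b 1)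

section Coordinates

variable (b : Module.Basis (Fin 2) ℤ (ℤ × ℤ))

/-- The determinant `det(b₁, b₂)` as a complex number. -/
def bdet : ℂ := (det (b 0) (b 1) : ℂ)

theorem eq_coords (r : ℤ × ℤ) : r = b.repr r 0 • b 0 + b.repr r 1 • b 1 := by
  conv_lhs => rw [← b.sum_repr r, Fin.sum_univ_two]

theorem coords_eq_zero {i j : ℤ} (hij : i • b 0 + j • b 1 = 0) : i = 0 ∧ j = 0 := by
  have h0 := congrArg (fun x => b.repr x 0) hij
  have h1 := congrArg (fun x => b.repr x 1) hij
  simp only [map_add, map_smul, map_zero, Finsupp.add_apply, Finsupp.smul_apply, b.repr_self,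
    Finsupp.zero_apply] at h0 h1
  simp at h0 h1
  exact ⟨h0, h1⟩

theorem bdet_ne_zero : bdet b ≠ 0 := by
  rw [bdet, Int.cast_ne_zero]
  intro hd
  rw [det] at hd
  have e1 : (b 1).2 • b 0 + (-(b 0).2) • b 1 = 0 := by
    ext
    · simp; linarith
    · simp; ring
  have e2 : (b 1).1 • b 0 + (-(b 0).1) • b 1 = 0 := by
    ext
    · simp; ring
    · simp; linarith
  have h1 := (coords_eq_zero b e1).2
  have h2 := (coords_eq_zero b e2).2
  refine b.ne_zero 0 ?_
  ext
  · simpa using h2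
  · simpa using h1

theorem h_coords (i j : ℤ) : h (i • b 0 + j • b 1) = (i : ℂ) • h (b 0) + (j : ℂ) • h (b 1) := by
  simp only [h, ← map_smul, ← map_add]
  congr 1
  ext <;> simp

@[simp] theorem E_zero_zero : E b 0 0 = 0 := by simp [E]

theorem E_mem (j m : ℤ) : E b j m ∈ gr b j := Submodule.mem_sup_left (Submodule.subset_span ⟨m, rfl⟩)

/-- The bracket in coordinates, away from the centre. -/
theorem E_lie_E {i m j n : ℤ} (hne : i + j ≠ 0 ∨ m + n ≠ 0) :
    ⁅E b i m, E b j n⁆ = (-bdet b * (i * n - m * j)) • E b (i + j) (m + n) := by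
  have e : i • b 0 + m • b 1 + (j • b 0 + n • b 1) = (i + j) • b 0 + (m + n) • b 1 := by
    module
  rw [E, E, D_lie_D, e, if_neg, add_zero, E]
  · congr 1
    rw [bdet, det, det]
    push_cast
    simp only [Prod.fst_add, Prod.snd_add, Prod.smul_fst, Prod.smul_snd, smul_eq_mul]
    push_cast
    ring
  · intro h0
    have := coords_eq_zero b h0
    omega

theorem E_lie_E_neg (i m : ℤ) :
    ⁅E b i m, E b (-i) (-m)⁆ = (i : ℂ) • h (b 0) + (m : ℂ) • h (b 1) := by
  have e : i • b 0 + m • b 1 + (-i • b 0 + -m • b 1) = 0 := by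
    module
  rw [E, E, D_lie_D, e, if_pos rfl, h_coords]
  simp

/-- The algebra is spanned by the `E b j m`, `h(b₁)` and `h(b₂)`. -/
theorem E_induction {p : VirasoroLike → Prop} (x : VirasoroLike)
    (hE : ∀ j m, p (E b j m)) (h0 : p (h (b 0))) (h1 : p (h (b 1)))
    (hadd : ∀ x y, p x → p y → p (x + y)) (hsmul : ∀ (a : ℂ) x, p x → p (a • x)) : p x := by
  refine induction_on x (fun r => ?_) (fun r => ?_) hadd hsmul
  · rw [eq_coords b r]; exact hE _ _
  · rw [eq_coords b r, h_coords]
    exact hadd _ _ (hsmul _ _ h0) (hsmul _ _ h1)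

theorem gr_induction {p : VirasoroLike → Prop} {j : ℤ} {x : VirasoroLike} (hx : x ∈ gr b j)
    (hE : ∀ m, p (E b j m)) (hh : j = 0 → ∀ m, p (h m)) (h0 : p 0)
    (hadd : ∀ x y, p x → p y → p (x + y)) (hsmul : ∀ (a : ℂ) x, p x → p (a • x)) : p x := by
  obtain ⟨y, hy, z, hz, rfl⟩ := Submodule.mem_sup.mp hx
  refine hadd _ _ ?_ ?_
  · refine Submodule.span_induction (p := fun y _ => p y) ?_ h0
      (fun x y _ _ => hadd x y) (fun a x _ => hsmul a x) hy
    rintro _ ⟨m, rfl⟩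
    exact hE m
  · split_ifs at hz with hj
    · refine Submodule.span_induction (p := fun y _ => p y) ?_ h0
        (fun x y _ _ => hadd x y) (fun a x _ => hsmul a x) hz
      rintro _ (rfl | rfl) <;> exact hh hj _
    · rw [(Submodule.mem_bot ℂ).mp hz]; exact h0

theorem gr_lie {i j : ℤ} {x y : VirasoroLike} (hx : x ∈ gr b i) (hy : y ∈ gr b j) :
    ⁅x, y⁆ ∈ gr b (i + j) := by
  refine gr_induction b (p := fun x => ⁅x, y⁆ ∈ gr b (i + j)) hx (fun m => ?_)
    (fun _ m => by rw [h_lie]; exact zero_mem _) (by simp)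
    (fun x x' hx hx' => by rw [add_lie]; exact add_mem hx hx')
    (fun a x hx => by rw [smul_lie]; exact Submodule.smul_mem _ _ hx)
  refine gr_induction b (p := fun y => ⁅E b i m, y⁆ ∈ gr b (i + j)) hy (fun n => ?_)
    (fun _ m => by rw [lie_h]; exact zero_mem _) (by simp)
    (fun x x' hx hx' => by rw [lie_add]; exact add_mem hx hx')
    (fun a x hx => by rw [lie_smul]; exact Submodule.smul_mem _ _ hx)
  by_cases hne : i + j ≠ 0 ∨ m + n ≠ 0
  · rw [E_lie_E b hne]
    exact Submodule.smul_mem _ _ (E_mem b _ _)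
  · obtain ⟨h1, h2⟩ : j = -i ∧ n = -m := by omega
    subst h1 h2
    rw [E_lie_E_neg, ← h_coords, add_neg_cancel]
    exact h_mem_gr_zero b _

theorem exists_E_lie_E {i m j n : ℤ} (hne : i + j ≠ 0 ∨ m + n ≠ 0) (hd : i * n - m * j ≠ 0) :
    ∃ c : ℂ, E b (i + j) (m + n) = c • ⁅E b i m, E b j n⁆ := by
  refine ⟨(-bdet b * (i * n - m * j))⁻¹, ?_⟩
  rw [E_lie_E b hne, smul_smul, inv_mul_cancel₀, one_smul]
  refine mul_ne_zero (neg_ne_zero.mpr (bdet_ne_zero b)) ?_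
  exact_mod_cast hd

end Coordinates

/-! ### Annihilators and graded irreducible modules -/

section Modules

variable {V : Type*} [AddCommGroup V] [Module ℂ V] [LieRingModule VirasoroLike V]
  [LieModule ℂ VirasoroLike V]
variable {b : Module.Basis (Fin 2) ℤ (ℤ × ℤ)}

theorem lie_eq_zero_of_lie {x y : VirasoroLike} {v : V} (hx : ⁅x, v⁆ = 0) (hy : ⁅y, v⁆ = 0) :
    ⁅⁅x, y⁆, v⁆ = 0 := by
  rw [lie_lie, hx, hy, lie_zero, lie_zero, sub_zero]

theorem E_lie_eq_zero {v : V} {i m j n : ℤ} (hx : ⁅E b i m, v⁆ = 0) (hy : ⁅E b j n, v⁆ = 0)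
    (hne : i + j ≠ 0 ∨ m + n ≠ 0) (hd : i * n - m * j ≠ 0) : ⁅E b (i + j) (m + n), v⁆ = 0 := by
  obtain ⟨c, hc⟩ := exists_E_lie_E b hne hd
  rw [hc, smul_lie, lie_eq_zero_of_lie hx hy, smul_zero]

/-- The element `D(-b₁)` and the `L_j` with `j ≥ J` generate `L`. -/
theorem lie_eq_zero_of_generators {v : V} (hv : ⁅E b (-1) 0, v⁆ = 0) {J : ℤ}
    (hJ : ∀ j, J ≤ j → ∀ m, ⁅E b j m, v⁆ = 0) (x : VirasoroLike) : ⁅x, v⁆ = 0 := by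
  have h1 : ∀ m, m ≠ 0 → ∀ n : ℕ, ⁅E b (J - n) m, v⁆ = 0 := by
    intro m hm n
    induction n with
    | zero => exact hJ _ (by simp) m
    | succ n ih =>
      have := E_lie_eq_zero hv ih (by simp [hm]) (by simpa using hm)
      convert this using 3
      · push_cast; ring
      · ring
  have h2 : ∀ m, m ≠ 0 → ∀ j, ⁅E b j m, v⁆ = 0 := by
    intro m hm j
    rcases le_total J j with hj | hj
    · exact hJ j hj m
    · convert h1 m hm (J - j).toNat using 3
      omega
  have h3 : ∀ j m, ⁅E b j m, v⁆ = 0 := by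
    intro j m
    by_cases hm : m = 0
    · subst hm
      by_cases hj : j = 0
      · subst hj; simp
      · have := E_lie_eq_zero (b := b) (h2 1 one_ne_zero 0) (h2 (-1) (by simp) j) (by simpa using hj)
          (by simpa using hj)
        simpa using this
    · exact h2 m hm j
  have h4 : ⁅h (b 1), v⁆ = 0 := by
    have := lie_eq_zero_of_lie (h3 0 1) (h3 (-0) (-1))
    rw [E_lie_E_neg] at this
    simpa using this
  have h5 : ⁅h (b 0), v⁆ = 0 := by
    have := lie_eq_zero_of_lie (h3 1 0) (h3 (-1) (-0))
    rw [E_lie_E_neg] at this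
    simpa using this
  refine E_induction b (p := fun x => ⁅x, v⁆ = 0) x h3 h5 h4 (fun x y hx hy => ?_) (fun a x hx => ?_)
  · rw [add_lie, hx, hy, add_zero]
  · rw [smul_lie, hx, smul_zero]

variable (b) in
/-- A family of subspaces `𝒱 n` that `L` shifts according to degree and for which there are no
graded submodules but `0` and `V`. Neither independence nor finite dimension is required. -/
structure IsGradedIrreducible (𝒱 : ℤ → Submodule ℂ V) : Prop where
  lie_mem : ∀ m n : ℤ, ∀ x ∈ gr b m, ∀ v ∈ 𝒱 n, ⁅x, v⁆ ∈ 𝒱 (m + n)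
  irreducible : ∀ W : LieSubmodule ℂ VirasoroLike V,
    IsGradedSubspace 𝒱 W.toSubmodule → W = ⊥ ∨ W = ⊤

theorem InO.isGradedIrreducible {𝒱 : ℤ → Submodule ℂ V} (hV : InO b 𝒱) :
    IsGradedIrreducible b 𝒱 := ⟨hV.lie_mem, hV.irreducible⟩

variable {𝒱 : ℤ → Submodule ℂ V}

theorem IsGradedIrreducible.E_mem (hV : IsGradedIrreducible b 𝒱) {n : ℤ} {v : V} (hv : v ∈ 𝒱 n)
    (j m : ℤ) : ⁅E b j m, v⁆ ∈ 𝒱 (j + n) := hV.lie_mem _ _ _ (VirasoroLike.E_mem b j m) _ hv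

variable (b) in
/-- The sum of a family of subspaces that `L` shifts according to degree. -/
def gradedSum (A : ℤ → Submodule ℂ V)
    (hA : ∀ m n : ℤ, ∀ x ∈ gr b m, ∀ v ∈ A n, ⁅x, v⁆ ∈ A (m + n)) :
    LieSubmodule ℂ VirasoroLike V where
  toSubmodule := ⨆ n, A n
  lie_mem := by
    intro x v hv
    change v ∈ ⨆ n, A n at hv
    change ⁅x, v⁆ ∈ ⨆ n, A n
    have hhom : ∀ j, ∀ x ∈ gr b j, ⁅x, v⁆ ∈ ⨆ n, A n := by
      intro j x hx
      refine Submodule.iSup_induction A (motive := fun v => ⁅x, v⁆ ∈ ⨆ n, A n) hv ?_ (by simp) ?_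
      · intro n v hv
        exact Submodule.mem_iSup_of_mem (j + n) (hA _ _ _ hx _ hv)
      · intro v w hv hw
        rw [lie_add]
        exact add_mem hv hw
    refine E_induction b (p := fun x => ⁅x, v⁆ ∈ ⨆ n, A n) x
      (fun j m => hhom j _ (VirasoroLike.E_mem b j m)) (hhom 0 _ (h_mem_gr_zero b _))
      (hhom 0 _ (h_mem_gr_zero b _)) (fun x y hx hy => ?_) (fun a x hx => ?_)
    · rw [add_lie]; exact add_mem hx hy
    · rw [smul_lie]; exact Submodule.smul_mem _ _ hx

theorem gradedSum_toSubmodule (A : ℤ → Submodule ℂ V)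
    (hA : ∀ m n : ℤ, ∀ x ∈ gr b m, ∀ v ∈ A n, ⁅x, v⁆ ∈ A (m + n)) :
    (gradedSum b A hA).toSubmodule = ⨆ n, A n := rfl

/-- A submodule of a graded irreducible module that contains a nonzero homogeneous vector is
everything, whether it is graded or not: its largest graded submodule is. -/
theorem IsGradedIrreducible.eq_top (hV : IsGradedIrreducible b 𝒱)
    (W : LieSubmodule ℂ VirasoroLike V) {v : V} (hv : v ∈ W) {n : ℤ} (hn : v ∈ 𝒱 n)
    (h0 : v ≠ 0) : W = ⊤ := by
  let W' := gradedSum b (fun n => W.toSubmodule ⊓ 𝒱 n)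
    fun m n x hx v hv => ⟨W.lie_mem hv.1, hV.lie_mem _ _ _ hx _ hv.2⟩
  have hW' : W'.toSubmodule = ⨆ n, W.toSubmodule ⊓ 𝒱 n := rfl
  have hmem : v ∈ W'.toSubmodule := by
    rw [hW']
    exact Submodule.mem_iSup_of_mem n ⟨hv, hn⟩
  have hgr : IsGradedSubspace 𝒱 W'.toSubmodule := by
    rw [IsGradedSubspace, hW']
    exact iSup_mono fun n => le_inf (le_iSup (fun n => W.toSubmodule ⊓ 𝒱 n) n) inf_le_right
  rcases hV.irreducible _ hgr with h1 | h1
  · rw [h1] at hmem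
    exact absurd ((LieSubmodule.mem_bot v).mp hmem) h0
  · rw [← LieSubmodule.toSubmodule_eq_top] at h1 ⊢
    rw [hW'] at h1
    exact top_le_iff.mp (h1 ▸ iSup_le fun n => inf_le_left)

/-- A nonzero homogeneous invariant spans the module. -/
theorem IsGradedIrreducible.span_eq_top (hV : IsGradedIrreducible b 𝒱) {v : V} {n : ℤ}
    (hn : v ∈ 𝒱 n) (h0 : v ≠ 0) (hv : ∀ x : VirasoroLike, ⁅x, v⁆ = 0) :
    Submodule.span ℂ {v} = ⊤ := by
  let W : LieSubmodule ℂ VirasoroLike V :=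
    { Submodule.span ℂ {v} with
      lie_mem := by
        intro x w hw
        obtain ⟨a, rfl⟩ := Submodule.mem_span_singleton.mp hw
        rw [lie_smul, hv, smul_zero]
        exact Submodule.zero_mem _ }
  have := hV.eq_top W (v := v) (Submodule.mem_span_singleton_self v) hn h0
  exact congrArg LieSubmodule.toSubmodule this

theorem IsGradedIrreducible.eq_zero_of_invariant (hV : IsGradedIrreducible b 𝒱)
    (hnt : ∃ (x : VirasoroLike) (v : V), ⁅x, v⁆ ≠ 0) {v : V} {n : ℤ}
    (hn : v ∈ 𝒱 n) (hv : ∀ x : VirasoroLike, ⁅x, v⁆ = 0) : v = 0 := by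
  by_contra h0
  obtain ⟨x, w, hw⟩ := hnt
  have hs : w ∈ Submodule.span ℂ {v} := by rw [hV.span_eq_top hn h0 hv]; trivial
  obtain ⟨a, rfl⟩ := Submodule.mem_span_singleton.mp hs
  exact hw (by rw [lie_smul, hv, smul_zero])

/-- `D(-b₁)` is injective on homogeneous vectors that are killed in high degrees. -/
theorem IsGradedIrreducible.eq_zero_of_E (hV : IsGradedIrreducible b 𝒱)
    (hnt : ∃ (x : VirasoroLike) (v : V), ⁅x, v⁆ ≠ 0) {v : V} {n : ℤ}
    (hn : v ∈ 𝒱 n) {J : ℤ} (hJ : ∀ j, J ≤ j → ∀ m, ⁅E b j m, v⁆ = 0)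
    (hv : ⁅E b (-1) 0, v⁆ = 0) : v = 0 :=
  hV.eq_zero_of_invariant hnt hn (lie_eq_zero_of_generators hv hJ)

/-- If one `D(j b₁ + m b₂)` with `j ≠ 0` kills a homogeneous subspace, all of `L_j` does:
bracket with the elements of `L_0`, which preserve that subspace. -/
theorem IsGradedIrreducible.E_lie_eq_zero_of_one (hV : IsGradedIrreducible b 𝒱) {j m k : ℤ}
    (hj : j ≠ 0) (hm : ∀ v ∈ 𝒱 k, ⁅E b j m, v⁆ = 0) (n : ℤ) : ∀ v ∈ 𝒱 k, ⁅E b j n, v⁆ = 0 := by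
  intro v hv
  by_cases hmn : n = m
  · rw [hmn]; exact hm v hv
  have h0 : ⁅E b 0 (n - m), v⁆ ∈ 𝒱 k := by simpa using hV.E_mem hv 0 (n - m)
  obtain ⟨c, hc⟩ := exists_E_lie_E b (i := 0) (m := n - m) (j := j) (n := m) (by simp [hj])
    (by simp [hj, sub_eq_zero, hmn])
  have e : E b j n = c • ⁅E b 0 (n - m), E b j m⁆ := by rw [← hc]; simp
  rw [e, smul_lie, lie_lie, hm _ h0, hm _ hv, lie_zero, sub_zero, smul_zero]

end Modules

/-! ### Irreducible modules with large homogeneous subspaces are bounded on one side -/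

section Bounded

variable {V : Type*} [AddCommGroup V] [Module ℂ V] [LieRingModule VirasoroLike V]
  [LieModule ℂ VirasoroLike V]
variable {b : Module.Basis (Fin 2) ℤ (ℤ × ℤ)}

variable (b V) in
/-- The vectors killed by all `D(i p + j q)` with `i` and `j` large, where `p = K b₁ + b₂` and
`q = (K + 1) b₁ + b₂` form a basis of `ℤ²`. They form a submodule since every translate of a
deep enough subcone of the cone spanned by `p` and `q` lies in that cone. -/
def coneKilled (K : ℤ) : LieSubmodule ℂ VirasoroLike V where
  carrier := {w | ∃ N : ℤ, ∀ i j, N ≤ i → N ≤ j →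
    ⁅E b (i * K + j * (K + 1)) (i + j), w⁆ = 0}
  zero_mem' := ⟨0, by simp⟩
  add_mem' := by
    rintro v w ⟨N, hN⟩ ⟨M, hM⟩
    refine ⟨max N M, fun i j hi hj => ?_⟩
    rw [lie_add, hN i j (by omega) (by omega), hM i j (by omega) (by omega), add_zero]
  smul_mem' := by
    rintro c w ⟨N, hN⟩
    exact ⟨N, fun i j hi hj => by rw [lie_smul, hN i j hi hj, smul_zero]⟩
  lie_mem := by
    rintro x w ⟨N, hN⟩
    change ∃ N : ℤ, ∀ i j, N ≤ i → N ≤ j → ⁅E b (i * K + j * (K + 1)) (i + j), ⁅x, w⁆⁆ = 0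
    refine E_induction b (p := fun x => ∃ N : ℤ, ∀ i j, N ≤ i → N ≤ j →
      ⁅E b (i * K + j * (K + 1)) (i + j), ⁅x, w⁆⁆ = 0) x (fun a c => ?_) ?_ ?_ ?_ ?_
    · -- `a b₁ + c b₂ = i' p + j' q`
      obtain ⟨j', hj'⟩ : ∃ j', j' = a - c * K := ⟨_, rfl⟩
      obtain ⟨i', hi'⟩ : ∃ i', i' = c - j' := ⟨_, rfl⟩
      refine ⟨max N 1 + |i'| + |j'|, fun i j hi hj => ?_⟩
      have h1 := abs_nonneg i'
      have h2 := abs_nonneg j'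
      have h3 := neg_abs_le i'
      have h4 := neg_abs_le j'
      have e1 : i * K + j * (K + 1) + a = (i + i') * K + (j + j') * (K + 1) := by
        rw [hi', hj']; ring
      have e2 : i + j + c = (i + i') + (j + j') := by omega
      rw [leibniz_lie, hN i j (by omega) (by omega), lie_zero, add_zero,
        E_lie_E b (Or.inr (by omega)), smul_lie, e1, e2, hN _ _ (by omega) (by omega), smul_zero]
    · exact ⟨N, fun i j hi hj => by rw [leibniz_lie, hN i j hi hj, lie_h, zero_lie, lie_zero,
        add_zero]⟩
    · exact ⟨N, fun i j hi hj => by rw [leibniz_lie, hN i j hi hj, lie_h, zero_lie, lie_zero,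
        add_zero]⟩
    · rintro x y ⟨N, hN⟩ ⟨M, hM⟩
      refine ⟨max N M, fun i j hi hj => ?_⟩
      rw [add_lie, lie_add, hN i j (by omega) (by omega), hM i j (by omega) (by omega), add_zero]
    · rintro c y ⟨N, hN⟩
      exact ⟨N, fun i j hi hj => by rw [smul_lie, lie_smul, hN i j hi hj, smul_zero]⟩

theorem mem_coneKilled {K : ℤ} {v : V} (hp : ⁅E b K 1, v⁆ = 0) (hq : ⁅E b (K + 1) 1, v⁆ = 0) :
    v ∈ coneKilled V b K := by
  have key : ∀ i j : ℕ, ⁅E b ((i + 1) * K + (j + 1) * (K + 1)) ((i + 1) + (j + 1)), v⁆ = 0 := by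
    intro i
    induction i with
    | zero =>
      intro j
      induction j with
      | zero =>
        have := E_lie_eq_zero hp hq (Or.inr (by norm_num)) (by ring_nf; norm_num)
        convert this using 3 <;> push_cast <;> ring
      | succ j ih =>
        have := E_lie_eq_zero hq ih (Or.inr (by push_cast; omega))
          (by push_cast; ring_nf; norm_num)
        convert this using 3 <;> push_cast <;> ring
    | succ i ih =>
      intro j
      have := E_lie_eq_zero hp (ih j) (Or.inr (by omega)) (by
        have e : K * ((i : ℤ) + 1 + (j + 1)) - 1 * ((i + 1) * K + (j + 1) * (K + 1)) = -(j + 1) := by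
          ring
        rw [e]; omega)
      convert this using 3 <;> push_cast <;> ring
  refine ⟨1, fun i j hi hj => ?_⟩
  convert key (i - 1).toNat (j - 1).toNat using 3
  · rw [Int.toNat_of_nonneg (by omega), Int.toNat_of_nonneg (by omega)]; ring
  · omega

variable {𝒱 : ℤ → Submodule ℂ V}

/-- Each homogeneous subspace is killed in all high degrees. -/
theorem IsGradedIrreducible.exists_killed (hV : IsGradedIrreducible b 𝒱)
    (hfin : ∀ n, FiniteDimensional ℂ (𝒱 n)) {K : ℤ} (hK : 0 < K) {v : V} {n : ℤ} (hn : v ∈ 𝒱 n)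
    (h0 : v ≠ 0) (hp : ⁅E b K 1, v⁆ = 0) (hq : ⁅E b (K + 1) 1, v⁆ = 0) (k : ℤ) :
    ∃ J : ℤ, ∀ j, J ≤ j → ∀ m, ∀ w ∈ 𝒱 k, ⁅E b j m, w⁆ = 0 := by
  have htop := hV.eq_top _ (mem_coneKilled hp hq) hn h0
  have hall : ∀ w : V, w ∈ coneKilled V b K := fun w => by rw [htop]; trivial
  choose N hN using hall
  have := hfin k
  let B := Module.finBasis ℂ (𝒱 k)
  obtain ⟨M, hM⟩ : ∃ M : ℤ, ∀ i, N (B i : V) ≤ M := by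
    obtain ⟨M, hM⟩ := (Set.finite_range fun i => N (B i : V)).bddAbove
    exact ⟨M, fun i => hM ⟨i, rfl⟩⟩
  have hkill : ∀ i j, M ≤ i → M ≤ j → ∀ w ∈ 𝒱 k,
      ⁅E b (i * K + j * (K + 1)) (i + j), w⁆ = 0 := by
    intro i j hi hj w hw
    have hker : (LieModule.toEnd ℂ VirasoroLike V (E b (i * K + j * (K + 1)) (i + j))) ∘ₗ
        (𝒱 k).subtype = 0 := by
      refine B.ext fun t => ?_
      exact hN (B t : V) i j ((hM t).trans hi) ((hM t).trans hj)
    exact LinearMap.congr_fun hker ⟨w, hw⟩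
  -- every degree from this bound on contains a point `i p + j q` of the deep cone
  refine ⟨max 1 (M * (2 * K + 1) + K * K), fun j hj m w hw => ?_⟩
  refine hV.E_lie_eq_zero_of_one (j := j) (by omega)
    (m := (j - M * (2 * K + 1)) / K + 2 * M) ?_ m w hw
  have h1 := Int.emod_nonneg (j - M * (2 * K + 1)) hK.ne'
  have h2 := Int.emod_lt_of_pos (j - M * (2 * K + 1)) hK
  have h3 := Int.mul_ediv_add_emod (j - M * (2 * K + 1)) K
  have h4 : K ≤ (j - M * (2 * K + 1)) / K := by
    rw [Int.le_ediv_iff_mul_le hK]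
    have := le_max_right 1 (M * (2 * K + 1) + K * K)
    linarith
  set r := (j - M * (2 * K + 1)) % K
  set q := (j - M * (2 * K + 1)) / K
  have := hkill (M + (q - r)) (M + r) (by omega) (by omega)
  convert this using 4
  congr 1
  · linarith
  · ring

/-- A graded irreducible module in which each homogeneous subspace is killed in all high degrees
vanishes in all high degrees. The degree from which on `L_j` kills `𝒱 k` can be chosen
independently of `k`, since `D(-b₁)` is injective and commutes with `D(j b₁)`; then
`[L_j, L_{-j}]`, which contains the `D(m b₂)`, kills `𝒱 k` for large `k`, and so does
`[L_0, L_{-1}]`, against the injectivity of `D(-b₁)`. -/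
theorem IsGradedIrreducible.eq_bot_of_killed (hV : IsGradedIrreducible b 𝒱)
    (hnt : ∃ (x : VirasoroLike) (v : V), ⁅x, v⁆ ≠ 0)
    (hkill : ∀ k, ∃ J : ℤ, ∀ j, J ≤ j → ∀ m, ∀ w ∈ 𝒱 k, ⁅E b j m, w⁆ = 0) :
    ∃ K : ℤ, ∀ k, K < k → 𝒱 k = ⊥ := by
  have hinj : ∀ k, ∀ w ∈ 𝒱 k, ⁅E b (-1) 0, w⁆ = 0 → w = 0 := by
    intro k w hw hw0
    obtain ⟨J, hJ⟩ := hkill k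
    exact hV.eq_zero_of_E hnt hw (fun j hj m => hJ j hj m w hw) hw0
  obtain ⟨J', hJ'⟩ := hkill 0
  obtain ⟨J, hJ2, hJ⟩ : ∃ J : ℤ, 2 ≤ J ∧ ∀ k : ℕ, ∀ j, J ≤ j → ∀ m, ∀ w ∈ 𝒱 k,
      ⁅E b j m, w⁆ = 0 := by
    refine ⟨max 2 J', le_max_left _ _, fun k => ?_⟩
    induction k with
    | zero => exact fun j hj m w hw => hJ' j (by omega) m w (by simpa using hw)
    | succ k ih =>
      intro j hj m
      refine hV.E_lie_eq_zero_of_one (m := 0) (by omega) (fun w hw => ?_) m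
      refine hinj _ _ (hV.E_mem hw j 0) ?_
      have h1 : ⁅E b (-1) 0, w⁆ ∈ 𝒱 k := by
        convert hV.E_mem hw (-1) 0 using 2
        push_cast; ring
      rw [leibniz_lie, E_lie_E b (Or.inl (by omega)), ih j hj 0 _ h1]
      simp
  have hL0 : ∀ k : ℤ, J ≤ k → ∀ n, ∀ w ∈ 𝒱 k, ⁅E b 0 n, w⁆ = 0 := by
    intro k hk n w hw
    by_cases hn : n = 0
    · subst hn; simp
    have h1 : ⁅E b (-J) 0, w⁆ ∈ 𝒱 ((k - J).toNat : ℤ) := by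
      convert hV.E_mem hw (-J) 0 using 2
      omega
    have h2 : w ∈ 𝒱 (k.toNat : ℤ) := by
      convert hw using 2
      omega
    obtain ⟨c, hc⟩ := exists_E_lie_E b (i := J) (m := n) (j := -J) (n := 0)
      (Or.inr (by simpa using hn)) (by simp [hn]; omega)
    have e : E b 0 n = c • ⁅E b J n, E b (-J) 0⁆ := by rw [← hc]; simp
    rw [e, smul_lie, lie_lie, hJ _ J le_rfl _ _ h1, hJ _ J le_rfl _ _ h2, lie_zero, sub_zero,
      smul_zero]
  refine ⟨J, fun k hk => ?_⟩
  rw [Submodule.eq_bot_iff]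
  intro w hw
  refine hinj k w hw ?_
  have h1 : ⁅E b (-1) (-1), w⁆ ∈ 𝒱 (-1 + k) := hV.E_mem hw _ _
  obtain ⟨c, hc⟩ := exists_E_lie_E b (i := 0) (m := 1) (j := -1) (n := -1)
    (Or.inl (by norm_num)) (by norm_num)
  have e : E b (-1) 0 = c • ⁅E b 0 1, E b (-1) (-1)⁆ := by rw [← hc]; simp
  rw [e, smul_lie, lie_lie, hL0 _ (by omega) _ _ h1, hL0 k hk.le _ _ hw, lie_zero, sub_zero,
    smul_zero]

theorem InO.exists_homogeneous (hV : InO b 𝒱) : ∃ n, 𝒱 n ≠ ⊥ := by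
  by_contra! hall
  have h1 := hV.isInternal.submodule_iSup_eq_top
  rw [iSup_eq_bot.mpr hall] at h1
  have := hV.nontrivial
  exact bot_ne_top h1

theorem InO.exists_lie_ne_zero (hV : InO b 𝒱) (hub : ¬ UniformlyBounded 𝒱) :
    ∃ (x : VirasoroLike) (v : V), ⁅x, v⁆ ≠ 0 := by
  by_contra! hall
  obtain ⟨n, hn⟩ := hV.exists_homogeneous
  obtain ⟨v, hv, h0⟩ := (Submodule.ne_bot_iff _).mp hn
  have htop := hV.isGradedIrreducible.span_eq_top hv h0 fun x => hall x v
  refine hub ⟨1, fun k => ?_⟩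
  calc Module.rank ℂ (𝒱 k) ≤ Module.rank ℂ V := Submodule.rank_le _
    _ = Module.rank ℂ (⊤ : Submodule ℂ V) := (rank_top ℂ V).symm
    _ = Module.rank ℂ (Submodule.span ℂ {v}) := by rw [htop]
    _ ≤ (1 : ℕ) := by
      have := rank_span_le (R := ℂ) ({v} : Set V)
      simpa using this

/-- If a homogeneous subspace of negative degree is larger than `𝒱 0` and `𝒱 1` together, the
module vanishes in all high degrees. -/
theorem InO.eq_bot_of_finrank_lt (hV : InO b 𝒱) (hub : ¬ UniformlyBounded 𝒱) {k : ℤ} (hk : k < 0)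
    (hdim : Module.finrank ℂ (𝒱 0) + Module.finrank ℂ (𝒱 1) < Module.finrank ℂ (𝒱 k)) :
    ∃ K : ℤ, ∀ n, K < n → 𝒱 n = ⊥ := by
  have hV' := hV.isGradedIrreducible
  have := hV.finite
  let f : 𝒱 k →ₗ[ℂ] 𝒱 0 := (LieModule.toEnd ℂ VirasoroLike V (E b (-k) 1)).restrict
    (fun v hv => by simpa using hV'.E_mem hv (-k) 1)
  let g : 𝒱 k →ₗ[ℂ] 𝒱 1 := (LieModule.toEnd ℂ VirasoroLike V (E b (-k + 1) 1)).restrict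
    (fun v hv => by
      have := hV'.E_mem hv (-k + 1) 1
      rw [show -k + 1 + k = 1 by ring] at this
      exact this)
  have hker : LinearMap.ker (f.prod g) ≠ ⊥ := by
    apply LinearMap.ker_ne_bot_of_finrank_lt
    rwa [Module.finrank_prod]
  obtain ⟨v, hv, h0⟩ := (Submodule.ne_bot_iff _).mp hker
  have hf : f v = 0 := congrArg Prod.fst (LinearMap.mem_ker.mp hv)
  have hg : g v = 0 := congrArg Prod.snd (LinearMap.mem_ker.mp hv)
  refine hV'.eq_bot_of_killed (hV.exists_lie_ne_zero hub)
    (hV'.exists_killed hV.finite (K := -k) (by omega) v.2 (by simpa using h0) ?_ ?_)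
  · exact congrArg Subtype.val hf
  · exact congrArg Subtype.val hg

end Bounded

/-! ### Reversing the grading -/

section Flip

/-- The basis `-b₁, b₂`, whose grading of `L` is the reversed one. -/
def flip (b : Module.Basis (Fin 2) ℤ (ℤ × ℤ)) : Module.Basis (Fin 2) ℤ (ℤ × ℤ) :=
  b.unitsSMul ![-1, 1]

variable (b : Module.Basis (Fin 2) ℤ (ℤ × ℤ))

@[simp] theorem flip_zero : flip b 0 = -b 0 := by simp [flip, Module.Basis.unitsSMul_apply]

@[simp] theorem flip_one : flip b 1 = b 1 := by simp [flip, Module.Basis.unitsSMul_apply]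

theorem gr_flip (j : ℤ) : gr (flip b) j = gr b (-j) := by
  rw [gr, gr]
  simp

variable {b}
variable {V : Type*} [AddCommGroup V] [Module ℂ V] [LieRingModule VirasoroLike V]
  [LieModule ℂ VirasoroLike V] {𝒱 : ℤ → Submodule ℂ V}

theorem isGradedSubspace_flip {W : Submodule ℂ V} :
    IsGradedSubspace (fun n => 𝒱 (-n)) W ↔ IsGradedSubspace 𝒱 W := by
  rw [IsGradedSubspace, IsGradedSubspace, ← (Equiv.neg ℤ).iSup_comp (g := fun n => W ⊓ 𝒱 n)]
  rfl

theorem InO.flip (hV : InO b 𝒱) : InO (flip b) (fun n => 𝒱 (-n)) where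
  isInternal := by
    rw [DirectSum.isInternal_submodule_iff_iSupIndep_and_iSup_eq_top]
    exact ⟨hV.isInternal.submodule_iSupIndep.comp neg_injective,
      ((Equiv.neg ℤ).iSup_comp (g := 𝒱)).trans hV.isInternal.submodule_iSup_eq_top⟩
  lie_mem m n x hx v hv := by
    rw [gr_flip] at hx
    rw [neg_add]
    exact hV.lie_mem _ _ x hx v hv
  finite n := hV.finite _
  nontrivial := hV.nontrivial
  irreducible W hW := hV.irreducible W (isGradedSubspace_flip.mp hW)

theorem uniformlyBounded_flip :
    UniformlyBounded (fun n => 𝒱 (-n)) ↔ UniformlyBounded 𝒱 := by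
  refine exists_congr fun N => ⟨fun hN n => ?_, fun hN n => hN _⟩
  have := hN (-n)
  rwa [show (fun n => 𝒱 (-n)) (-n) = 𝒱 n from congrArg 𝒱 (neg_neg n)] at this

theorem InO.bounded_above_or_below (hV : InO b 𝒱) (hub : ¬ UniformlyBounded 𝒱) :
    (∃ K : ℤ, ∀ n, K < n → 𝒱 n = ⊥) ∨ ∃ K : ℤ, ∀ n, n < K → 𝒱 n = ⊥ := by
  obtain ⟨k, hk⟩ : ∃ k, Module.finrank ℂ (𝒱 (-1)) + Module.finrank ℂ (𝒱 0) +
      Module.finrank ℂ (𝒱 1) < Module.finrank ℂ (𝒱 k) := by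
    by_contra! hall
    refine hub ⟨Module.finrank ℂ (𝒱 (-1)) + Module.finrank ℂ (𝒱 0) + Module.finrank ℂ (𝒱 1),
      fun n => ?_⟩
    have := hV.finite n
    rw [← Module.finrank_eq_rank]
    exact_mod_cast hall n
  rcases lt_trichotomy k 0 with h1 | h1 | h1
  · exact Or.inl (hV.eq_bot_of_finrank_lt hub h1 (by omega))
  · subst h1; omega
  · obtain ⟨K, hK⟩ := hV.flip.eq_bot_of_finrank_lt
      (fun h => hub (uniformlyBounded_flip.mp h)) (k := -k) (by omega)
      (by rw [neg_neg, neg_zero]; omega)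
    refine Or.inr ⟨-K, fun n hn => ?_⟩
    have := hK (-n) (by omega)
    rwa [neg_neg] at this

end Flip

/-! ### Two-sided linear recurrences -/

section Recurrence

/-- The shift `(S f)(k) = f(k + 1)` on two-sided sequences. -/
def shift : Module.End ℂ (ℤ → ℂ) := LinearMap.funLeft ℂ ℂ (fun k => k + 1)

theorem shift_apply (f : ℤ → ℂ) (k : ℤ) : shift f k = f (k + 1) := rfl

/-- The sequence `k ↦ k ^ n β ^ k`. -/
def powExp (β : ℂ) (n : ℕ) : ℤ → ℂ := fun k => (k : ℂ) ^ n * β ^ k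

/-- The space of exp-polynomial sequences. -/
def expPoly : Submodule ℂ (ℤ → ℂ) :=
  Submodule.span ℂ {f | ∃ (β : ℂ) (n : ℕ), β ≠ 0 ∧ f = powExp β n}

theorem powExp_mem {β : ℂ} (hβ : β ≠ 0) (n : ℕ) : powExp β n ∈ expPoly :=
  Submodule.subset_span ⟨β, n, hβ, rfl⟩

theorem shift_powExp {β : ℂ} (hβ : β ≠ 0) (n : ℕ) :
    shift (powExp β n) = β • ∑ j ∈ Finset.range (n + 1), (n.choose j : ℂ) • powExp β j := by
  funext k
  simp only [shift_apply, powExp, Pi.smul_apply, Finset.sum_apply, smul_eq_mul]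
  push_cast
  rw [add_pow, zpow_add_one₀ hβ, Finset.mul_sum, Finset.sum_mul]
  refine Finset.sum_congr rfl fun j _ => ?_
  rw [one_pow]; ring

theorem shift_pow_apply (f : ℤ → ℂ) (n : ℕ) (k : ℤ) : (shift ^ n) f k = f (k + n) := by
  induction n generalizing k with
  | zero => simp
  | succ n ih =>
    rw [pow_succ', Module.End.mul_apply, shift_apply, ih]
    congr 1
    push_cast; ring

/-- `S - α` maps exp-polynomial sequences onto exp-polynomial sequences. -/
theorem expPoly_le_map (α : ℂ) :
    expPoly ≤ expPoly.map (shift - algebraMap ℂ (Module.End ℂ (ℤ → ℂ)) α) := by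
  refine Submodule.span_le.mpr ?_
  rintro _ ⟨β, n, hβ, rfl⟩
  induction n using Nat.strong_induction_on with
  | _ n ih =>
  set T := shift - algebraMap ℂ (Module.End ℂ (ℤ → ℂ)) α with hT
  have hlow : ∀ c : ℕ → ℂ, ∑ j ∈ Finset.range n, c j • powExp β j ∈ expPoly.map T := fun c =>
    Submodule.sum_mem _ fun j hj => Submodule.smul_mem _ _ (ih j (Finset.mem_range.mp hj))
  by_cases hαβ : β = α
  · subst hαβ
    have e : powExp β n = ((β * (n + 1))⁻¹ : ℂ) • (T (powExp β (n + 1)) -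
        β • ∑ j ∈ Finset.range n, ((n + 1).choose j : ℂ) • powExp β j) := by
      have hn : (n : ℂ) + 1 ≠ 0 := Nat.cast_add_one_ne_zero n
      rw [eq_inv_smul_iff₀ (mul_ne_zero hβ hn), hT, LinearMap.sub_apply, shift_powExp hβ,
        Finset.sum_range_succ, Finset.sum_range_succ, Nat.choose_self, Nat.choose_succ_self_right,
        Module.algebraMap_end_apply]
      push_cast
      module
    change powExp β n ∈ expPoly.map T
    rw [e]
    exact Submodule.smul_mem _ _ (sub_mem (Submodule.mem_map_of_mem (powExp_mem hβ _))
      (Submodule.smul_mem _ _ (hlow _)))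
  · have e : powExp β n = ((β - α)⁻¹ : ℂ) • (T (powExp β n) -
        β • ∑ j ∈ Finset.range n, (n.choose j : ℂ) • powExp β j) := by
      rw [eq_inv_smul_iff₀ (sub_ne_zero.mpr hαβ), hT, LinearMap.sub_apply, shift_powExp hβ,
        Finset.sum_range_succ, Nat.choose_self, Module.algebraMap_end_apply]
      push_cast
      module
    change powExp β n ∈ expPoly.map T
    rw [e]
    exact Submodule.smul_mem _ _ (sub_mem (Submodule.mem_map_of_mem (powExp_mem hβ _))
      (Submodule.smul_mem _ _ (hlow _)))

theorem mem_expPoly_of_shift_sub {α : ℂ} {f : ℤ → ℂ}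
    (hf : (shift - algebraMap ℂ (Module.End ℂ (ℤ → ℂ)) α) f ∈ expPoly) : f ∈ expPoly := by
  obtain ⟨u, hu, hfu⟩ := expPoly_le_map α hf
  suffices hw : f - u ∈ expPoly by simpa using add_mem hw hu
  have hrec : ∀ k : ℤ, (f - u) (k + 1) = α * (f - u) k := by
    intro k
    have h1 := congrFun hfu k
    simp only [LinearMap.sub_apply, Module.algebraMap_end_apply, Pi.sub_apply, shift_apply,
      Pi.smul_apply, smul_eq_mul] at h1 ⊢
    linear_combination -h1
  by_cases hα : α = 0
  · have h0 : f - u = 0 := by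
      funext k
      have := hrec (k - 1)
      rwa [hα, zero_mul, sub_add_cancel] at this
    rw [h0]; exact zero_mem _
  · have h0 : f - u = (f - u) 0 • powExp α 0 := by
      funext k
      induction k using Int.induction_on with
      | zero => simp [powExp]
      | succ k ih =>
        rw [hrec, ih]
        simp only [powExp, Pi.smul_apply, smul_eq_mul, pow_zero]
        rw [zpow_add_one₀ hα]; ring
      | pred k ih =>
        have h1 := hrec (-k - 1)
        rw [sub_add_cancel, ih] at h1
        refine mul_left_cancel₀ hα (h1.symm.trans ?_)
        simp only [powExp, Pi.smul_apply, smul_eq_mul, pow_zero]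
        rw [zpow_sub_one₀ hα]; field_simp
    rw [h0]
    exact Submodule.smul_mem _ _ (powExp_mem hα 0)

theorem mem_expPoly_of_aeval {p : Polynomial ℂ} (hp : p ≠ 0) {f : ℤ → ℂ}
    (hf : Polynomial.aeval shift p f = 0) : f ∈ expPoly := by
  have hs : ∀ (s : Multiset ℂ) (f : ℤ → ℂ),
      Polynomial.aeval shift (s.map fun a => Polynomial.X - Polynomial.C a).prod f = 0 →
      f ∈ expPoly := by
    intro s
    induction s using Multiset.induction_on with
    | empty => intro f hf; simp at hf; rw [hf]; exact zero_mem _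
    | cons a s ih =>
      intro f hf
      refine mem_expPoly_of_shift_sub (α := a) (ih _ ?_)
      rw [Multiset.map_cons, Multiset.prod_cons, mul_comm, map_mul, Module.End.mul_apply] at hf
      simpa using hf
  refine hs p.roots f ?_
  have h1 := (IsAlgClosed.splits p).eq_prod_roots
  rw [h1, map_mul, Polynomial.aeval_C, Module.End.mul_apply, Module.algebraMap_end_apply] at hf
  exact (smul_eq_zero.mp hf).resolve_left (by simpa using hp)

/-- A two-sided sequence satisfying a linear recurrence is exp-polynomial. -/
theorem mem_expPoly_of_recurrence {a : ℤ →₀ ℂ} (ha : a ≠ 0) {f : ℤ → ℂ}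
    (hf : ∀ r : ℤ, (a.sum fun m c => c * f (r + m)) = 0) : f ∈ expPoly := by
  obtain ⟨N, hN⟩ : ∃ N : ℤ, ∀ m ∈ a.support, 0 ≤ m + N := by
    obtain ⟨M, hM⟩ := a.support.bddBelow
    exact ⟨-M, fun m hm => by have := hM hm; omega⟩
  let p : Polynomial ℂ := ∑ m ∈ a.support, Polynomial.C (a m) * Polynomial.X ^ (m + N).toNat
  have hp : p ≠ 0 := by
    obtain ⟨m₀, hm₀⟩ := Finsupp.support_nonempty_iff.mpr ha
    intro h0
    have h1 := congrArg (fun q => Polynomial.coeff q (m₀ + N).toNat) h0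
    simp only [p, Polynomial.finsetSum_coeff, Polynomial.coeff_C_mul_X_pow,
      Polynomial.coeff_zero] at h1
    rw [Finset.sum_eq_single m₀] at h1
    · rw [if_pos rfl] at h1
      exact Finsupp.mem_support_iff.mp hm₀ h1
    · intro m hm hne
      rw [if_neg]
      have := hN m hm
      have := hN m₀ hm₀
      omega
    · exact fun h2 => absurd hm₀ h2
  refine mem_expPoly_of_aeval hp ?_
  funext r
  have h1 := hf (r + N)
  rw [Finsupp.sum] at h1
  rw [Pi.zero_apply, ← h1]
  simp only [p, map_sum, map_mul, map_pow, Polynomial.aeval_C, Polynomial.aeval_X,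
    LinearMap.sum_apply, Finset.sum_apply, Module.End.mul_apply, Module.algebraMap_end_apply,
    Pi.smul_apply, smul_eq_mul]
  refine Finset.sum_congr rfl fun m hm => ?_
  rw [shift_pow_apply]
  congr 2
  have := hN m hm
  omega

theorem exists_eq_sum_of_mem_expPoly {f : ℤ → ℂ} (hf : f ∈ expPoly) :
    ∃ (r : ℕ) (P : Fin r → Polynomial ℂ) (α : Fin r → ℂ), (∀ i, α i ≠ 0) ∧
      ∀ k : ℤ, f k = ∑ i, (P i).eval (k : ℂ) * α i ^ k := by
  obtain ⟨r, c, g, hg⟩ := (Submodule.mem_span_set' ..).mp hf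
  choose β n hβ hgβ using fun i => (g i).2
  refine ⟨r, fun i => Polynomial.C (c i) * Polynomial.X ^ n i, β, hβ, fun k => ?_⟩
  rw [← hg, Finset.sum_apply]
  refine Finset.sum_congr rfl fun i _ => ?_
  rw [Pi.smul_apply, hgβ i]
  simp [powExp, mul_assoc]

end Recurrence

/-! ### Modules generated by vectors killed on one side -/

section LowWords

variable {V : Type*} [AddCommGroup V] [Module ℂ V] [LieRingModule VirasoroLike V]
  [LieModule ℂ VirasoroLike V]

/-- The vectors `x₁ ⋯ x_k v` with `v ∈ X` and homogeneous `x_i` of degrees of sign opposite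
to `s`, together with the sum of these degrees. -/
inductive LowWord (b : Module.Basis (Fin 2) ℤ (ℤ × ℤ)) (s : ℤˣ) (X : Submodule ℂ V) : ℤ → V → Prop
  | base {v : V} : v ∈ X → LowWord b s X 0 v
  | step {n j : ℤ} {v : V} {x : VirasoroLike} : LowWord b s X n v → (s : ℤ) * j < 0 → x ∈ gr b j →
      LowWord b s X (j + n) ⁅x, v⁆

/-- The span of the low words of degree `n`. -/
def lowSpan (b : Module.Basis (Fin 2) ℤ (ℤ × ℤ)) (s : ℤˣ) (X : Submodule ℂ V) (n : ℤ) :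
    Submodule ℂ V := Submodule.span ℂ {v | LowWord b s X n v}

variable {b : Module.Basis (Fin 2) ℤ (ℤ × ℤ)} {s : ℤˣ} {X : Submodule ℂ V}

theorem LowWord.degree {n : ℤ} {v : V} (hv : LowWord b s X n v) :
    (s : ℤ) * n < 0 ∨ (n = 0 ∧ v ∈ X) := by
  induction hv with
  | base hv => exact Or.inr ⟨rfl, hv⟩
  | step _ hj _ ih =>
    left
    rw [mul_add]
    rcases ih with ih | ⟨rfl, _⟩
    · omega
    · simpa using hj

theorem lowSpan_eq_bot {n : ℤ} (hn : 0 < (s : ℤ) * n) : lowSpan b s X n = ⊥ := by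
  rw [lowSpan, Submodule.span_eq_bot]
  intro v hv
  rcases hv.degree with h1 | ⟨rfl, _⟩
  · omega
  · simp at hn

theorem lowSpan_zero_le : lowSpan b s X 0 ≤ X := by
  refine Submodule.span_le.mpr fun v hv => ?_
  rcases hv.degree with h1 | ⟨_, h1⟩
  · simp at h1
  · exact h1

theorem le_lowSpan_zero : X ≤ lowSpan b s X 0 :=
  fun _ hv => Submodule.subset_span (LowWord.base hv)

theorem lie_mem_lowSpan_of_neg {n j : ℤ} {v : V} {x : VirasoroLike} (hv : v ∈ lowSpan b s X n)
    (hj : (s : ℤ) * j < 0) (hx : x ∈ gr b j) : ⁅x, v⁆ ∈ lowSpan b s X (j + n) := by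
  refine Submodule.span_induction (p := fun v _ => ⁅x, v⁆ ∈ lowSpan b s X (j + n))
    (fun v hv => Submodule.subset_span (LowWord.step hv hj hx)) (by simp)
    (fun v w _ _ hv hw => by rw [lie_add]; exact add_mem hv hw)
    (fun a v _ hv => by rw [lie_smul]; exact Submodule.smul_mem _ _ hv) hv

/-- If `L_0` preserves `X` and `L_+` kills it (`L_-` for `s = -1`), then the low words span the
submodule generated by `X`: move the factors of nonnegative degree to the right. -/
theorem lie_mem_lowSpan (h0 : ∀ x ∈ gr b 0, ∀ v ∈ X, ⁅x, v⁆ ∈ X)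
    (hpos : ∀ j, 0 < (s : ℤ) * j → ∀ x ∈ gr b j, ∀ v ∈ X, ⁅x, v⁆ = 0)
    (j n : ℤ) (x : VirasoroLike) (hx : x ∈ gr b j) (v : V) (hv : v ∈ lowSpan b s X n) :
    ⁅x, v⁆ ∈ lowSpan b s X (j + n) := by
  have hword : ∀ {n : ℤ} {v : V}, LowWord b s X n v → ∀ j, ∀ x ∈ gr b j,
      ⁅x, v⁆ ∈ lowSpan b s X (j + n) := by
    intro n v hv
    induction hv with
    | @base v hv =>
      intro j x hx
      rcases lt_trichotomy ((s : ℤ) * j) 0 with hj | hj | hj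
      · exact Submodule.subset_span (LowWord.step (LowWord.base hv) hj hx)
      · obtain rfl : j = 0 := by simpa using hj
        exact Submodule.subset_span (LowWord.base (h0 x hx v hv))
      · rw [hpos j hj x hx v hv]; exact zero_mem _
    | @step n i v y hw hi hy ih =>
      intro j x hx
      rw [leibniz_lie]
      refine add_mem ?_ ?_
      · rw [← add_assoc]
        exact ih _ _ (gr_lie b hx hy)
      · rw [add_left_comm]
        exact lie_mem_lowSpan_of_neg (ih _ _ hx) hi hy
  refine Submodule.span_induction (p := fun v _ => ⁅x, v⁆ ∈ lowSpan b s X (j + n))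
    (fun v hv => hword hv j x hx) (by simp)
    (fun v w _ _ hv hw => by rw [lie_add]; exact add_mem hv hw)
    (fun a v _ hv => by rw [lie_smul]; exact Submodule.smul_mem _ _ hv) hv

variable {𝒱 : ℤ → Submodule ℂ V}

/-- A homogeneous vector killed by `L_+` lies in the top degree. -/
theorem InO.eq_bot_of_killed (hV : InO b 𝒱) {K : ℤ} {v : V} (hv : v ∈ 𝒱 K) (hv0 : v ≠ 0)
    (hkill : ∀ j, 0 < j → ∀ x ∈ gr b j, ⁅x, v⁆ = 0) {n : ℤ} (hn : K < n) : 𝒱 n = ⊥ := by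
  let X : Submodule ℂ V :=
    { carrier := {w | w ∈ 𝒱 K ∧ ∀ j, 0 < j → ∀ x ∈ gr b j, ⁅x, w⁆ = 0}
      zero_mem' := ⟨zero_mem _, by simp⟩
      add_mem' := fun {v w} hv hw => ⟨add_mem hv.1 hw.1, fun j hj x hx => by
        rw [lie_add, hv.2 j hj x hx, hw.2 j hj x hx, add_zero]⟩
      smul_mem' := fun a w hw => ⟨Submodule.smul_mem _ _ hw.1, fun j hj x hx => by
        rw [lie_smul, hw.2 j hj x hx, smul_zero]⟩ }
  have h0 : ∀ x ∈ gr b 0, ∀ v ∈ X, ⁅x, v⁆ ∈ X := by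
    intro x hx v hv
    refine ⟨by simpa using hV.lie_mem 0 K x hx v hv.1, fun j hj y hy => ?_⟩
    rw [leibniz_lie, hv.2 j hj y hy, lie_zero, add_zero]
    refine hv.2 j hj _ ?_
    simpa using gr_lie b hy hx
  have hpos : ∀ j, 0 < ((1 : ℤˣ) : ℤ) * j → ∀ x ∈ gr b j, ∀ v ∈ X, ⁅x, v⁆ = 0 :=
    fun j hj x hx v hv => hv.2 j (by simpa using hj) x hx
  have htop : gradedSum b (lowSpan b 1 X) (lie_mem_lowSpan h0 hpos) = ⊤ := by
    refine hV.isGradedIrreducible.eq_top _ (v := v) ?_ hv hv0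
    exact Submodule.mem_iSup_of_mem (p := lowSpan b 1 X) 0 (le_lowSpan_zero ⟨hv, hkill⟩)
  have hword : ∀ {m : ℤ} {w : V}, LowWord b 1 X m w → w ∈ 𝒱 (m + K) := by
    intro m w hw
    induction hw with
    | base hw => simpa using hw.1
    | step _ _ hx ih =>
      rw [add_assoc]
      exact hV.lie_mem _ _ _ hx _ ih
  have hle : (⊤ : Submodule ℂ V) ≤ ⨆ (m : ℤ) (_ : m ≠ n), 𝒱 m := by
    rw [← LieSubmodule.top_toSubmodule (L := VirasoroLike), ← htop, gradedSum_toSubmodule]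
    refine iSup_le fun m => ?_
    rcases lt_or_ge 0 m with hm | hm
    · rw [lowSpan_eq_bot (by simpa using hm)]
      exact bot_le
    · refine le_trans (Submodule.span_le.mpr fun w hw => hword hw) ?_
      exact le_iSup₂_of_le (m + K) (by omega) le_rfl
  have hdis := hV.isInternal.submodule_iSupIndep n
  rw [top_le_iff.mp hle] at hdis
  exact hdis.eq_bot_of_le le_top

end LowWords

/-! ### Extremal vectors -/

section Extremal

variable {V : Type*} [AddCommGroup V] [Module ℂ V] [LieRingModule VirasoroLike V]
  [LieModule ℂ VirasoroLike V]

/-- A highest weight vector (`s = 1`) or lowest weight vector (`s = -1`) of weight `ψ`. The vector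
may be zero. -/
structure IsExtremal (b : Module.Basis (Fin 2) ℤ (ℤ × ℤ)) (s : ℤˣ) (ψ : gr b 0 →ₗ[ℂ] ℂ) (v : V) :
    Prop where
  killed : ∀ j, 0 < (s : ℤ) * j → ∀ x ∈ gr b j, ⁅x, v⁆ = 0
  eigen : ∀ x : gr b 0, ⁅(x : VirasoroLike), v⁆ = ψ x • v

variable {b : Module.Basis (Fin 2) ℤ (ℤ × ℤ)} {ψ : gr b 0 →ₗ[ℂ] ℂ} {v : V}

theorem IsExtremal.apply_h_one {s : ℤˣ} (hv : IsExtremal b s ψ v) (h0 : v ≠ 0) :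
    ψ (h₀ b (b 1)) = 0 := by
  have h1 : ⁅⁅E b 0 1, E b (-0) (-1)⁆, v⁆ = ψ (h₀ b (b 1)) • v := by
    rw [E_lie_E_neg, Int.cast_zero, zero_smul, zero_add, Int.cast_one, one_smul]
    exact hv.eigen (h₀ b (b 1))
  have e1 := hv.eigen ⟨_, E_mem b 0 1⟩
  have e2 := hv.eigen ⟨_, E_mem b (-0) (-1)⟩
  rw [lie_lie, e1, e2, lie_smul, lie_smul, e1, e2, smul_comm, sub_self] at h1
  exact (smul_eq_zero.mp h1.symm).resolve_right h0

/-- The sequence `f(k) = k ψ(D(k b₂))` for `k ≠ 0`, with `f(0) = -ψ(h(b₁)) / det(b₁, b₂)`. It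
governs the pairing of `L_i` with `L_{-i}` on an extremal vector. -/
def weightSeq (ψ : gr b 0 →ₗ[ℂ] ℂ) (k : ℤ) : ℂ :=
  if k = 0 then -ψ (h₀ b (b 0)) / bdet b else k * ψ (D₀ b k)

theorem E_zero_eq (k : ℤ) : E b 0 k = D₀ b k := by simp [E, D₀]

theorem IsExtremal.lie_lie (hv : IsExtremal b 1 ψ v) (h0 : v ≠ 0) {i : ℤ} (hi : 0 < i) (m n : ℤ) :
    ⁅E b i m, ⁅E b (-i) n, v⁆⁆ = (-bdet b * i * weightSeq ψ (m + n)) • v := by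
  rw [leibniz_lie, hv.killed i (by simpa using hi) _ (E_mem b i m), lie_zero, add_zero]
  by_cases hmn : m + n = 0
  · obtain rfl : n = -m := by omega
    have hd := bdet_ne_zero b
    have e0 := hv.eigen (h₀ b (b 0))
    have e1 := hv.eigen (h₀ b (b 1))
    rw [hv.apply_h_one h0, zero_smul] at e1
    change ⁅h (b 0), v⁆ = _ at e0
    change ⁅h (b 1), v⁆ = _ at e1
    rw [E_lie_E_neg, weightSeq, if_pos hmn, add_lie, smul_lie, smul_lie, e0, e1, smul_zero,
      add_zero, smul_smul]
    congr 1
    field_simp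
  · rw [E_lie_E b (Or.inr hmn), weightSeq, if_neg hmn, smul_lie, add_neg_cancel, E_zero_eq,
      hv.eigen, smul_smul]
    congr 1
    push_cast
    ring

theorem eq_zero_of_weightSeq (h1 : ψ (h₀ b (b 1)) = 0) (hf : ∀ k, weightSeq ψ k = 0) : ψ = 0 := by
  have hd := bdet_ne_zero b
  have e0 : ψ (h₀ b (b 0)) = 0 := by
    have := hf 0
    rw [weightSeq, if_pos rfl] at this
    simpa [hd] using this
  have hD : ∀ k, ψ (D₀ b k) = 0 := by
    intro k
    by_cases hk : k = 0
    · have : D₀ b k = 0 := by subst hk; ext; simp [D₀]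
      rw [this, map_zero]
    · have := hf k
      rw [weightSeq, if_neg hk] at this
      simpa [hk] using this
  have key : ∀ x ∈ gr b 0, ∀ hx : x ∈ gr b 0, ψ ⟨x, hx⟩ = 0 := by
    intro x hx
    refine (gr_induction b (p := fun x => x ∈ gr b 0 ∧ ∀ hx : x ∈ gr b 0, ψ ⟨x, hx⟩ = 0) hx
      ?_ ?_ ?_ ?_ ?_).2
    · intro k
      refine ⟨E_mem b 0 k, fun hx => ?_⟩
      convert hD k
      exact E_zero_eq k
    · intro _ r
      refine ⟨h_mem_gr_zero b r, fun hx => ?_⟩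
      have e : (⟨h r, hx⟩ : gr b 0) = (b.repr r 0 : ℂ) • h₀ b (b 0) +
          (b.repr r 1 : ℂ) • h₀ b (b 1) := by
        ext
        change h r = (b.repr r 0 : ℂ) • h (b 0) + (b.repr r 1 : ℂ) • h (b 1)
        rw [← h_coords, ← eq_coords]
      rw [e, map_add, map_smul, map_smul, e0, h1, smul_zero, smul_zero, add_zero]
    · exact ⟨zero_mem _, fun hx => map_zero ψ⟩
    · rintro x y ⟨hx, hx'⟩ ⟨hy, hy'⟩
      refine ⟨add_mem hx hy, fun h => ?_⟩
      have := map_add ψ ⟨x, hx⟩ ⟨y, hy⟩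
      rw [hx' hx, hy' hy, add_zero] at this
      exact this
    · rintro a x ⟨hx, hx'⟩
      refine ⟨Submodule.smul_mem _ a hx, fun h => ?_⟩
      have := map_smul ψ a ⟨x, hx⟩
      rw [hx' hx, smul_zero] at this
      exact this
  ext ⟨x, hx⟩
  exact key x hx hx

theorem exists_weightSeq_ne_zero (h1 : ψ (h₀ b (b 1)) = 0) (hψ : ψ ≠ 0) :
    ∃ k, weightSeq ψ k ≠ 0 := by
  by_contra! hf
  exact hψ (eq_zero_of_weightSeq h1 hf)

variable {𝒱 : ℤ → Submodule ℂ V}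

/-- The vectors `D(-b₁)^{n-i} D(-i b₁ + k b₂) v`, `1 ≤ i ≤ n`, are linearly independent when
`f(k) ≠ 0`: applying `D(n b₁)` shows that `D(-n b₁ + k b₂) v` does not lie in the image of the
injective map `D(-b₁)`. -/
theorem IsExtremal.exists_linearIndependent (hV : IsGradedIrreducible b 𝒱)
    (hv : IsExtremal b 1 ψ v) (h0 : v ≠ 0) (hψ : ψ ≠ 0) {K : ℤ} (hK : v ∈ 𝒱 K)
    (htop : ∀ n, K < n → 𝒱 n = ⊥) (n : ℕ) :
    ∃ u : Fin n → V, LinearIndependent ℂ u ∧ ∀ i, u i ∈ 𝒱 (-n + K) := by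
  obtain ⟨k, hk⟩ := exists_weightSeq_ne_zero (hv.apply_h_one h0) hψ
  have hnt : ∃ (x : VirasoroLike) (v : V), ⁅x, v⁆ ≠ 0 := by
    obtain ⟨x, hx⟩ : ∃ x, ψ x ≠ 0 := by
      by_contra! hall
      exact hψ (LinearMap.ext hall)
    exact ⟨x, v, by rw [hv.eigen]; exact smul_ne_zero hx h0⟩
  have hhigh : ∀ m, ∀ w ∈ 𝒱 m, ∀ j, K < j + m → ∀ r, ⁅E b j r, w⁆ = 0 := by
    intro m w hw j hj r
    have := hV.E_mem hw j r
    rw [htop _ hj] at this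
    exact (Submodule.mem_bot ℂ).mp this
  induction n with
  | zero => exact ⟨Fin.elim0, linearIndependent_empty_type, fun i => i.elim0⟩
  | succ n ih =>
    obtain ⟨u, hu, hun⟩ := ih
    let T : V →ₗ[ℂ] V := LieModule.toEnd ℂ VirasoroLike V (E b (-1) 0)
    have hspan : Submodule.span ℂ (Set.range u) ≤ 𝒱 (-n + K) := by
      rw [Submodule.span_le]
      rintro _ ⟨i, rfl⟩
      exact hun i
    refine ⟨Fin.cons ⁅E b (-((n + 1 : ℕ) : ℤ)) k, v⁆ (T ∘ u), ?_, ?_⟩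
    · rw [linearIndependent_finCons]
      constructor
      · refine hu.map ?_
        rw [Submodule.disjoint_def]
        intro w hw hw0
        refine hV.eq_zero_of_E hnt (hspan hw) (J := n + 1) (fun j hj m => ?_) hw0
        exact hhigh _ _ (hspan hw) _ (by omega) m
      · rw [Set.range_comp, ← Submodule.map_span]
        rintro ⟨w, hw, hwv⟩
        have hw' := hspan hw
        have hpos : (0 : ℤ) < ((n + 1 : ℕ) : ℤ) := by omega
        have h1 := hv.lie_lie h0 hpos 0 k
        rw [← hwv, zero_add] at h1
        change ⁅E b _ 0, ⁅E b (-1) 0, w⁆⁆ = _ at h1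
        rw [leibniz_lie, hhigh _ _ hw' _ (by push_cast; omega), lie_zero, add_zero] at h1
        have h2 : ⁅⁅E b ((n + 1 : ℕ) : ℤ) 0, E b (-1) 0⁆, w⁆ = 0 := by
          by_cases hn : n = 0
          · subst hn
            -- there is nothing in the span of the empty family
            have : w = 0 := by simpa using hw
            rw [this, lie_zero]
          · rw [E_lie_E b (Or.inl (by push_cast; omega))]
            simp
        rw [h2] at h1
        refine smul_ne_zero ?_ h0 h1.symm
        refine mul_ne_zero (mul_ne_zero (neg_ne_zero.mpr (bdet_ne_zero b)) ?_) hk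
        exact_mod_cast hpos.ne'
    · intro i
      refine Fin.cases ?_ (fun i => ?_) i
      · exact hV.E_mem hK _ _
      · have := hV.E_mem (hun i) (-1) 0
        rwa [show -1 + (-(n : ℤ) + K) = -((n + 1 : ℕ) : ℤ) + K by push_cast; ring] at this

theorem IsExtremal.le_rank (hV : IsGradedIrreducible b 𝒱)
    (hv : IsExtremal b 1 ψ v) (h0 : v ≠ 0) (hψ : ψ ≠ 0) {K : ℤ} (hK : v ∈ 𝒱 K)
    (htop : ∀ n, K < n → 𝒱 n = ⊥) (n : ℕ) : (n : Cardinal) ≤ Module.rank ℂ (𝒱 (-n + K)) := by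
  obtain ⟨u, hu, hun⟩ := hv.exists_linearIndependent hV h0 hψ hK htop n
  have hli : LinearIndependent ℂ (fun i => (⟨u i, hun i⟩ : 𝒱 (-n + K))) :=
    LinearIndependent.of_comp (𝒱 (-n + K)).subtype hu
  have := hli.cardinal_lift_le_rank
  simpa using this

theorem IsExtremal.not_uniformlyBounded (hV : IsGradedIrreducible b 𝒱)
    (hv : IsExtremal b 1 ψ v) (h0 : v ≠ 0) (hψ : ψ ≠ 0) {K : ℤ} (hK : v ∈ 𝒱 K)
    (htop : ∀ n, K < n → 𝒱 n = ⊥) : ¬ UniformlyBounded 𝒱 := by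
  rintro ⟨N, hN⟩
  have h1 := (hv.le_rank hV h0 hψ hK htop (N + 1)).trans (hN _)
  have h2 : N + 1 ≤ N := by exact_mod_cast h1
  omega

/-- In a module with finite dimensional homogeneous subspaces, the vectors `D(-b₁ + m b₂) v` are
linearly dependent; applying `D(b₁ + r b₂)` to a dependency gives a recurrence for `weightSeq`. -/
theorem IsExtremal.isExpPolynomial (hV : InO b 𝒱)
    (hnt : ∃ (x : VirasoroLike) (v : V), ⁅x, v⁆ ≠ 0)
    (hv : IsExtremal b 1 ψ v) (h0 : v ≠ 0) {K : ℤ} (hK : v ∈ 𝒱 K) : IsExpPolynomial b ψ := by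
  have hd := bdet_ne_zero b
  have h1 := hv.apply_h_one h0
  have htop := fun n hn => hV.eq_bot_of_killed (n := n) hK h0
    (fun j hj => hv.killed j (by simpa using hj)) hn
  refine ⟨?_, h1, ?_⟩
  · rintro rfl
    have hK' := hV.isGradedIrreducible.E_mem hK (-1) 0
    -- `D(-b₁) v` is again killed by `L_+`, so it vanishes
    have hw : ⁅E b (-1) 0, v⁆ = 0 := by
      by_contra hw
      have hkill : ∀ j, 0 < j → ∀ x ∈ gr b j, ⁅x, ⁅E b (-1) 0, v⁆⁆ = 0 := by
        intro j hj x hx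
        refine gr_induction b (p := fun x => ⁅x, ⁅E b (-1) 0, v⁆⁆ = 0) hx (fun m => ?_)
          (fun h => absurd h hj.ne') (zero_lie _)
          (fun x y hx hy => by rw [add_lie, hx, hy, add_zero])
          (fun a x hx => by rw [smul_lie, hx, smul_zero])
        by_cases hj1 : j = 1
        · subst hj1
          rw [hv.lie_lie h0 one_pos]
          simp [weightSeq]
        · rw [leibniz_lie, hv.killed j (by simpa using hj) _ (E_mem b j m), lie_zero, add_zero,
            E_lie_E b (Or.inl (by omega)), smul_lie,
            hv.killed (j + -1) (by simp; omega) _ (E_mem b _ _), smul_zero]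
      have := hV.eq_bot_of_killed hK' hw hkill (n := K) (by omega)
      rw [this] at hK
      exact h0 ((Submodule.mem_bot ℂ).mp hK)
    refine h0 (hV.isGradedIrreducible.eq_zero_of_E hnt hK (J := 1) (fun j hj m => ?_) hw)
    exact hv.killed j (by simp; omega) _ (E_mem b j m)
  · have := hV.finite (-1 + K)
    let w : ℤ → 𝒱 (-1 + K) := fun m =>
      ⟨⁅E b (-1) m, v⁆, hV.isGradedIrreducible.E_mem hK (-1) m⟩
    have hdep : ¬ LinearIndependent ℂ w := fun hli =>
      Infinite.not_finite (α := ℤ) hli.finite_of_isNoetherian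
    rw [linearIndependent_iff] at hdep
    push Not at hdep
    obtain ⟨a, ha, ha0⟩ := hdep
    have hmem : weightSeq ψ ∈ expPoly := by
      refine mem_expPoly_of_recurrence ha0 fun r => ?_
      have h2 := congrArg (fun w : 𝒱 (-1 + K) => ⁅E b 1 r, (w : V)⁆) ha
      have h3 : ∀ m, ⁅E b 1 r, ((w m : 𝒱 (-1 + K)) : V)⁆ =
          (-bdet b * ((1 : ℤ) : ℂ) * weightSeq ψ (r + m)) • v := fun m => hv.lie_lie h0 one_pos r m
      simp only [Finsupp.linearCombination_apply, Finsupp.sum, Submodule.coe_sum, lie_sum,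
        Submodule.coe_smul, lie_smul, h3, smul_smul, Submodule.coe_zero, lie_zero] at h2
      rw [← Finset.sum_smul] at h2
      have h4 := (smul_eq_zero.mp h2).resolve_right h0
      rw [Finsupp.sum]
      have h5 : -bdet b * ∑ m ∈ a.support, a m * weightSeq ψ (r + m) = 0 := by
        rw [← h4, Finset.mul_sum]
        refine Finset.sum_congr rfl fun m _ => ?_
        push_cast; ring
      exact (mul_eq_zero.mp h5).resolve_left (neg_ne_zero.mpr hd)
    obtain ⟨r, P, α, hα, hf⟩ := exists_eq_sum_of_mem_expPoly hmem
    refine ⟨r, P, α, hα, fun k hk => ?_, ?_⟩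
    · rw [← hf, weightSeq, if_neg hk]
      have : (k : ℂ) ≠ 0 := by exact_mod_cast hk
      field_simp
    · have h2 := hf 0
      rw [weightSeq, if_pos rfl] at h2
      simp only [zpow_zero, mul_one, Int.cast_zero, ← Polynomial.coeff_zero_eq_eval_zero] at h2
      rw [← h2]
      change _ = -bdet b * _
      field_simp

end Extremal

/-! ### Existence of extremal vectors -/

section Existence

variable {V : Type*} [AddCommGroup V] [Module ℂ V] [LieRingModule VirasoroLike V]
  [LieModule ℂ VirasoroLike V]
variable {b : Module.Basis (Fin 2) ℤ (ℤ × ℤ)} {𝒱 : ℤ → Submodule ℂ V}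

/-- A finite dimensional nonzero subspace that `L_0` preserves contains a common eigenvector. On a
minimal such subspace the central elements act by scalars; the scalar of `h(b₂)`, being the
trace of a commutator, is zero, so that `L_0` acts by commuting operators, hence by scalars. -/
theorem exists_eigenvector {W₀ : Submodule ℂ V} [FiniteDimensional ℂ W₀] (hne : W₀ ≠ ⊥)
    (hst : ∀ x ∈ gr b 0, ∀ w ∈ W₀, ⁅x, w⁆ ∈ W₀) :
    ∃ v ∈ W₀, v ≠ 0 ∧ ∀ x ∈ gr b 0, ∃ c : ℂ, ⁅x, v⁆ = c • v := by
  let P : Submodule ℂ V → Prop := fun W =>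
    W ≤ W₀ ∧ W ≠ ⊥ ∧ ∀ x ∈ gr b 0, ∀ w ∈ W, ⁅x, w⁆ ∈ W
  obtain ⟨W, ⟨hle, hW0, hWst⟩, hmin⟩ : ∃ W, P W ∧ ∀ W', P W' →
      Module.finrank ℂ W ≤ Module.finrank ℂ W' := by
    have hex : ∃ n, ∃ W, P W ∧ Module.finrank ℂ W = n := ⟨_, W₀, ⟨le_rfl, hne, hst⟩, rfl⟩
    classical
    obtain ⟨W, hW, hn⟩ := Nat.find_spec hex
    exact ⟨W, hW, fun W' hW' => hn ▸ Nat.find_min' hex ⟨W', hW', rfl⟩⟩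
  have hfin : FiniteDimensional ℂ W := Submodule.finiteDimensional_of_le hle
  have hnt : Nontrivial W := Submodule.nontrivial_iff_ne_bot.mpr hW0
  have hscalar : ∀ x ∈ gr b 0, (∀ y ∈ gr b 0, ∀ w ∈ W, ⁅x, ⁅y, w⁆⁆ = ⁅y, ⁅x, w⁆⁆) →
      ∃ c : ℂ, ∀ w ∈ W, ⁅x, w⁆ = c • w := by
    intro x hx hcomm
    let T : Module.End ℂ W := (LieModule.toEnd ℂ VirasoroLike V x).restrict (hWst x hx)
    obtain ⟨c, hc⟩ := Module.End.exists_eigenvalue T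
    obtain ⟨w, hw⟩ := hc.exists_hasEigenvector
    let W' : Submodule ℂ V := W ⊓
      LinearMap.ker (LieModule.toEnd ℂ VirasoroLike V x - algebraMap ℂ (Module.End ℂ V) c)
    have hmem : ∀ u, u ∈ W' ↔ u ∈ W ∧ ⁅x, u⁆ = c • u := fun u => by
      simp [W', sub_eq_zero]
    have hW' : P W' := by
      refine ⟨inf_le_left.trans hle, ?_, fun y hy u hu => ?_⟩
      · refine (Submodule.ne_bot_iff _).mpr ⟨w, (hmem _).mpr ⟨w.2, ?_⟩, by simpa using hw.2⟩
        exact congrArg Subtype.val hw.apply_eq_smul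
      · rw [hmem] at hu ⊢
        exact ⟨hWst y hy u hu.1, by rw [hcomm y hy u hu.1, hu.2, lie_smul]⟩
    have heq : W' = W := Submodule.eq_of_le_of_finrank_le inf_le_left (hmin W' hW')
    exact ⟨c, fun u hu => ((hmem u).mp (heq ▸ hu)).2⟩
  have hcentral : ∀ r, ∃ c : ℂ, ∀ w ∈ W, ⁅h r, w⁆ = c • w := fun r =>
    hscalar _ (h_mem_gr_zero b r) fun y _ w _ => by rw [leibniz_lie, h_lie, zero_lie, zero_add]
  have hh1 : ∀ w ∈ W, ⁅h (b 1), w⁆ = 0 := by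
    obtain ⟨c, hc⟩ := hcentral (b 1)
    let A : Module.End ℂ W :=
      (LieModule.toEnd ℂ VirasoroLike V (E b 0 1)).restrict (hWst _ (E_mem b 0 1))
    let B : Module.End ℂ W :=
      (LieModule.toEnd ℂ VirasoroLike V (E b (-0) (-1))).restrict (hWst _ (E_mem b (-0) (-1)))
    have hAB : A * B - B * A = c • 1 := by
      ext w
      change ⁅E b 0 1, ⁅E b (-0) (-1), (w : V)⁆⁆ - ⁅E b (-0) (-1), ⁅E b 0 1, (w : V)⁆⁆ = c • (w : V)
      rw [← lie_lie, E_lie_E_neg, Int.cast_zero, zero_smul, zero_add, Int.cast_one, one_smul,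
        hc w w.2]
    have htr := congrArg (LinearMap.trace ℂ W) hAB
    rw [map_sub, LinearMap.trace_mul_comm, sub_self, map_smul, LinearMap.trace_one,
      smul_eq_mul] at htr
    have hdim : (Module.finrank ℂ W : ℂ) ≠ 0 := by exact_mod_cast Module.finrank_pos.ne'
    have hc0 : c = 0 := (mul_eq_zero.mp htr.symm).resolve_right hdim
    intro w hw
    rw [hc w hw, hc0, zero_smul]
  have hbracket : ∀ x ∈ gr b 0, ∀ y ∈ gr b 0, ∀ w ∈ W, ⁅⁅x, y⁆, w⁆ = 0 := by
    intro x hx y hy w hw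
    refine gr_induction b (p := fun x => ⁅⁅x, y⁆, w⁆ = 0) hx (fun m => ?_)
      (fun _ r => by rw [h_lie, zero_lie]) (by simp)
      (fun x x' hx hx' => by rw [add_lie, add_lie, hx, hx', add_zero])
      (fun a x hx => by rw [smul_lie, smul_lie, hx, smul_zero])
    refine gr_induction b (p := fun y => ⁅⁅E b 0 m, y⁆, w⁆ = 0) hy (fun n => ?_)
      (fun _ r => by rw [lie_h, zero_lie]) (by simp)
      (fun x x' hx hx' => by rw [lie_add, add_lie, hx, hx', add_zero])
      (fun a x hx => by rw [lie_smul, smul_lie, hx, smul_zero])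
    by_cases hmn : m + n = 0
    · obtain rfl : n = -m := by omega
      have := E_lie_E_neg b 0 m
      rw [neg_zero] at this
      rw [this, add_lie, smul_lie, smul_lie, hh1 w hw]
      simp
    · rw [E_lie_E b (Or.inr hmn)]
      simp
  obtain ⟨v, hv, hv0⟩ := (Submodule.ne_bot_iff _).mp hW0
  refine ⟨v, hle hv, hv0, fun x hx => ?_⟩
  obtain ⟨c, hc⟩ := hscalar x hx fun y hy w hw => by
    rw [leibniz_lie, hbracket x hx y hy w hw, zero_add]
  exact ⟨c, hc v hv⟩

/-- Eigenvalues on a common eigenvector depend linearly on the element of `L_0`. -/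
theorem exists_weight {v : V} (h0 : v ≠ 0) (hv : ∀ x ∈ gr b 0, ∃ c : ℂ, ⁅x, v⁆ = c • v) :
    ∃ ψ : gr b 0 →ₗ[ℂ] ℂ, ∀ x : gr b 0, ⁅(x : VirasoroLike), v⁆ = ψ x • v := by
  choose c hc using fun x : gr b 0 => hv x x.2
  have hinj : ∀ a a' : ℂ, a • v = a' • v → a = a' := fun a a' h => smul_left_injective ℂ h0 h
  refine ⟨{ toFun := c, map_add' := fun x y => hinj _ _ ?_, map_smul' := fun a x => hinj _ _ ?_ },
    hc⟩
  · rw [← hc, add_smul, ← hc, ← hc, Submodule.coe_add, add_lie]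
  · rw [← hc, Submodule.coe_smul, smul_lie, hc, smul_smul]
    rfl

theorem InO.exists_isExtremal (hV : InO b 𝒱) (hbd : ∃ K : ℤ, ∀ n, K < n → 𝒱 n = ⊥) :
    ∃ (K : ℤ) (v : V) (ψ : gr b 0 →ₗ[ℂ] ℂ), v ∈ 𝒱 K ∧ v ≠ 0 ∧ IsExtremal b 1 ψ v := by
  obtain ⟨K₀, hK₀⟩ := hbd
  obtain ⟨K, hK, hmax⟩ := Int.exists_greatest_of_bdd (P := fun n => 𝒱 n ≠ ⊥)
    ⟨K₀, fun n hn => not_lt.mp fun h => hn (hK₀ n h)⟩ hV.exists_homogeneous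
  have hfin := hV.finite K
  obtain ⟨v, hv, h0, heig⟩ := exists_eigenvector (b := b) hK fun x hx w hw => by
    simpa using hV.lie_mem 0 K x hx w hw
  obtain ⟨ψ, hψ⟩ := exists_weight h0 heig
  refine ⟨K, v, ψ, hv, h0, fun j hj x hx => ?_, hψ⟩
  have hmem := hV.lie_mem j K x hx v hv
  have hbot : 𝒱 (j + K) = ⊥ := by
    by_contra hne
    have h1 := hmax _ hne
    have h2 : 0 < j := by simpa using hj
    omega
  rw [hbot] at hmem
  exact (Submodule.mem_bot ℂ).mp hmem

/-- The homogeneous components of an extremal vector are extremal. -/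
theorem IsExtremal.exists_homogeneous (hV : IsGradedModule b 𝒱) {s : ℤˣ} {ψ : gr b 0 →ₗ[ℂ] ℂ}
    {v : V} (hv : IsExtremal b s ψ v) (h0 : v ≠ 0) :
    ∃ (n : ℤ) (w : V), w ∈ 𝒱 n ∧ w ≠ 0 ∧ IsExtremal b s ψ w := by
  classical
  let _ := hV.isInternal.chooseDecomposition
  have hcomp : ∀ j, ∀ x ∈ gr b j, ∀ i, ∀ v : V,
      (DirectSum.decompose 𝒱 ⁅x, v⁆ (j + i) : V) = ⁅x, (DirectSum.decompose 𝒱 v i : V)⁆ := by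
    intro j x hx i v
    induction v using DirectSum.Decomposition.inductionOn 𝒱 with
    | zero => simp
    | @homogeneous k w =>
      have hmem := hV.lie_mem j k x hx w w.2
      by_cases hik : k = i
      · subst hik
        rw [DirectSum.decompose_of_mem_same 𝒱 hmem, DirectSum.decompose_of_mem_same 𝒱 w.2]
      · rw [DirectSum.decompose_of_mem_ne 𝒱 hmem (by omega),
          DirectSum.decompose_of_mem_ne 𝒱 w.2 hik, lie_zero]
    | add v w hv hw =>
      rw [lie_add, DirectSum.decompose_add, DirectSum.decompose_add, DirectSum.add_apply,
        DirectSum.add_apply, Submodule.coe_add, Submodule.coe_add, hv, hw, lie_add]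
  obtain ⟨n, hn⟩ : ∃ n, (DirectSum.decompose 𝒱 v n : V) ≠ 0 := by
    by_contra! hall
    refine h0 ?_
    rw [← DirectSum.sum_support_decompose 𝒱 v]
    exact Finset.sum_eq_zero fun i _ => hall i
  refine ⟨n, _, (DirectSum.decompose 𝒱 v n).2, hn, fun j hj x hx => ?_, fun x => ?_⟩
  · rw [← hcomp j x hx, hv.killed j hj x hx]
    simp
  · rw [← hcomp 0 x x.2, hv.eigen, zero_add, DirectSum.decompose_smul]
    rfl

end Existence

/-! ### Reversing the grading of extremal vectors -/

section FlipExtremal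

variable {b : Module.Basis (Fin 2) ℤ (ℤ × ℤ)}

theorem gr_flip_zero (b : Module.Basis (Fin 2) ℤ (ℤ × ℤ)) : gr (flip b) 0 = gr b 0 := by
  rw [gr_flip, neg_zero]

/-- A linear function on `L_0` does not depend on the direction of the grading. -/
def flipEquiv (b : Module.Basis (Fin 2) ℤ (ℤ × ℤ)) : gr (flip b) 0 ≃ₗ[ℂ] gr b 0 :=
  LinearEquiv.ofEq _ _ (gr_flip_zero b)

theorem flipEquiv_coe (x : gr (flip b) 0) : (flipEquiv b x : VirasoroLike) = x :=
  LinearEquiv.coe_ofEq_apply _ x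

theorem flipEquiv_symm_coe (x : gr b 0) : ((flipEquiv b).symm x : VirasoroLike) = x := by
  rw [← flipEquiv_coe, LinearEquiv.apply_symm_apply]

theorem isExpPolynomial_flip {ψ : gr b 0 →ₗ[ℂ] ℂ} :
    IsExpPolynomial (flip b) (ψ ∘ₗ (flipEquiv b : gr (flip b) 0 →ₗ[ℂ] gr b 0)) ↔
      IsExpPolynomial b ψ := by
  have e1 : ∀ r, flipEquiv b (h₀ (flip b) r) = h₀ b r := fun r =>
    Subtype.ext (flipEquiv_coe _)
  have e2 : ∀ k, flipEquiv b (D₀ (flip b) k) = D₀ b k := fun k => by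
    refine Subtype.ext ((flipEquiv_coe _).trans ?_)
    exact congrArg (fun r => D (k • r)) (flip_one b)
  have e3 : h₀ b (-b 0) = -h₀ b (b 0) := by
    exact Subtype.ext ((h_neg (b 0)).trans (NegMemClass.coe_neg (h₀ b (b 0))).symm)
  have e4 : (det (-b 0) (b 1) : ℂ) = -(det (b 0) (b 1) : ℂ) := by simp [det]; ring
  have e5 : ψ ∘ₗ (flipEquiv b : gr (flip b) 0 →ₗ[ℂ] gr b 0) ≠ 0 ↔ ψ ≠ 0 := by
    refine not_congr ⟨fun h => ?_, fun h => by rw [h, LinearMap.zero_comp]⟩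
    ext x
    simpa using LinearMap.congr_fun h ((flipEquiv b).symm x)
  simp only [IsExpPolynomial, LinearMap.comp_apply, LinearEquiv.coe_coe, e1, e2, flip_zero,
    flip_one, e3, e4, map_neg, e5]
  refine and_congr Iff.rfl (and_congr Iff.rfl ?_)
  refine exists_congr fun r => exists_congr fun P => exists_congr fun α => and_congr Iff.rfl
    (and_congr Iff.rfl ?_)
  rw [neg_eq_iff_eq_neg, neg_mul, neg_neg, neg_mul]

variable {V : Type*} [AddCommGroup V] [Module ℂ V] [LieRingModule VirasoroLike V]
  [LieModule ℂ VirasoroLike V]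

theorem isExtremal_flip {ψ : gr b 0 →ₗ[ℂ] ℂ} {v : V} :
    IsExtremal (flip b) 1 (ψ ∘ₗ (flipEquiv b : gr (flip b) 0 →ₗ[ℂ] gr b 0)) v ↔
      IsExtremal b (-1) ψ v := by
  constructor
  · intro hv
    refine ⟨fun j hj x hx => hv.killed (-j) (by simpa using hj) x ?_, fun x => ?_⟩
    · rwa [gr_flip, neg_neg]
    · have := hv.eigen ((flipEquiv b).symm x)
      rwa [LinearMap.comp_apply, LinearEquiv.coe_coe, LinearEquiv.apply_symm_apply,
        flipEquiv_symm_coe] at this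
  · intro hv
    refine ⟨fun j hj x hx => hv.killed (-j) (by simpa using hj) x ?_, fun x => ?_⟩
    · rwa [gr_flip] at hx
    · have := hv.eigen (flipEquiv b x)
      rwa [flipEquiv_coe] at this

theorem exists_eq_flip (ψ : gr (flip b) 0 →ₗ[ℂ] ℂ) :
    ∃ ψ' : gr b 0 →ₗ[ℂ] ℂ, ψ = ψ' ∘ₗ (flipEquiv b : gr (flip b) 0 →ₗ[ℂ] gr b 0) :=
  ⟨ψ ∘ₗ ((flipEquiv b).symm : gr b 0 →ₗ[ℂ] gr (flip b) 0), by ext x; simp⟩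

end FlipExtremal

/-! ### Enveloping algebras and the grading of the induced module -/

section Induced

theorem mem_of_ι_mem {L : Type*} [LieRing L] [LieAlgebra ℂ L]
    (A : Subalgebra ℂ (UniversalEnvelopingAlgebra ℂ L))
    (h : ∀ x : L, UniversalEnvelopingAlgebra.ι ℂ x ∈ A) (u : UniversalEnvelopingAlgebra ℂ L) :
    u ∈ A := by
  obtain ⟨t, rfl⟩ : ∃ t, UniversalEnvelopingAlgebra.mkAlgHom ℂ L t = u :=
    RingCon.mkₐ_surjective (α := ℂ) _ u
  have key : ∀ t, t ∈ A.comap (UniversalEnvelopingAlgebra.mkAlgHom ℂ L) := by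
    intro t
    induction t using TensorAlgebra.induction with
    | algebraMap r => exact Subalgebra.algebraMap_mem _ r
    | ι x => exact h x
    | mul a b ha hb => exact mul_mem ha hb
    | add a b ha hb => exact add_mem ha hb
  exact key t

/-- A subspace of a module over the enveloping algebra that is stable under the Lie algebra is
stable under the enveloping algebra. -/
theorem smul_mem_of_ι_smul_mem {L : Type*} [LieRing L] [LieAlgebra ℂ L] {M : Type*}
    [AddCommGroup M] [Module ℂ M] [Module (UniversalEnvelopingAlgebra ℂ L) M]
    [IsScalarTower ℂ (UniversalEnvelopingAlgebra ℂ L) M] (P : Submodule ℂ M)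
    (h : ∀ (x : L), ∀ w ∈ P, UniversalEnvelopingAlgebra.ι ℂ x • w ∈ P)
    (u : UniversalEnvelopingAlgebra ℂ L) {w : M} (hw : w ∈ P) : u • w ∈ P := by
  let A : Subalgebra ℂ (UniversalEnvelopingAlgebra ℂ L) :=
    { carrier := {u | ∀ w ∈ P, u • w ∈ P}
      mul_mem' := fun {a b} ha hb w hw => by rw [mul_smul]; exact ha _ (hb _ hw)
      add_mem' := fun {a b} ha hb w hw => by rw [add_smul]; exact add_mem (ha _ hw) (hb _ hw)
      algebraMap_mem' := fun a w hw => by rw [algebraMap_smul]; exact P.smul_mem a hw }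
  exact mem_of_ι_mem A h u w hw

variable (b : Module.Basis (Fin 2) ℤ (ℤ × ℤ)) (s : ℤˣ) (ψ : gr b 0 →ₗ[ℂ] ℂ)

/-- `L` acts on the induced module through `L → U(L)`. -/
instance : LieRingModule VirasoroLike (VBar b s ψ) where
  bracket x v := ι x • v
  add_lie x y v := by
    show ι (x + y) • v = ι x • v + ι y • v
    rw [← add_smul]; congr 1; exact map_add _ x y
  lie_add x v w := smul_add _ _ _
  leibniz_lie x y v := by
    show ι x • ι y • v = ι ⁅x, y⁆ • v + ι y • ι x • v
    rw [ι_lie, sub_smul, mul_smul, mul_smul]; abel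

instance : LieModule ℂ VirasoroLike (VBar b s ψ) where
  smul_lie a x v := by
    show ι (a • x) • v = a • ι x • v
    rw [← smul_assoc]; congr 1; exact map_smul _ a x
  lie_smul a x v := by
    show ι x • a • v = a • ι x • v
    rw [← algebraMap_smul U a v, ← algebraMap_smul U a (ι x • v), ← mul_smul, ← mul_smul,
      Algebra.commutes]

theorem one_mem_grU : (1 : U) ∈ grU b 0 :=
  Submodule.subset_span ⟨[], by simp, by simp, by simp⟩

theorem ι_mul_mem_grU {j n : ℤ} {x : VirasoroLike} (hx : x ∈ gr b j) {u : U} (hu : u ∈ grU b n) :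
    ι x * u ∈ grU b (j + n) := by
  refine Submodule.span_induction (p := fun u _ => ι x * u ∈ grU b (j + n)) ?_ (by simp)
    (fun u w _ _ hu hw => by rw [mul_add]; exact add_mem hu hw)
    (fun a u _ hu => by rw [mul_smul_comm]; exact Submodule.smul_mem _ _ hu) hu
  rintro _ ⟨l, hl, rfl, rfl⟩
  refine Submodule.subset_span ⟨(j, x) :: l, ?_, by simp, by simp⟩
  intro p hp
  rcases List.mem_cons.mp hp with rfl | hp
  · exact hx
  · exact hl p hp

/-- The generator `v₀` of the induced module. -/
def vBar : VBar b s ψ := Submodule.Quotient.mk 1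

theorem smul_vBar (u : U) : u • vBar b s ψ = Submodule.Quotient.mk u := by
  rw [vBar, ← Submodule.Quotient.mk_smul, smul_eq_mul, mul_one]

theorem eq_top_of_vBar_mem {W : Submodule U (VBar b s ψ)} (h : vBar b s ψ ∈ W) : W = ⊤ := by
  rw [eq_top_iff]
  rintro w -
  obtain ⟨u, rfl⟩ := Submodule.Quotient.mk_surjective _ w
  rw [← smul_vBar]
  exact W.smul_mem u h

theorem isExtremal_vBar : IsExtremal b s ψ (vBar b s ψ) where
  killed j hj x hx := by
    change ι x • vBar b s ψ = 0
    rw [smul_vBar, Submodule.Quotient.mk_eq_zero]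
    exact Submodule.subset_span (Or.inr ⟨j, hj, x, hx, rfl⟩)
  eigen x := by
    change ι (x : VirasoroLike) • vBar b s ψ = ψ x • vBar b s ψ
    rw [← algebraMap_smul U (ψ x), smul_vBar, smul_vBar, Submodule.Quotient.eq]
    exact Submodule.subset_span (Or.inl ⟨x, rfl⟩)

theorem vBar_mem : vBar b s ψ ∈ grVBar b s ψ 0 :=
  Submodule.mem_map_of_mem (one_mem_grU b)

theorem lie_mem_grVBar (j n : ℤ) (x : VirasoroLike) (hx : x ∈ gr b j) (w : VBar b s ψ)
    (hw : w ∈ grVBar b s ψ n) : ⁅x, w⁆ ∈ grVBar b s ψ (j + n) := by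
  obtain ⟨u, hu, rfl⟩ := hw
  exact Submodule.mem_map_of_mem (ι_mul_mem_grU b hx hu)

variable {b s ψ}

theorem grVBar_le {Q : ℤ → Submodule ℂ (VBar b s ψ)} (h0 : vBar b s ψ ∈ Q 0)
    (hQ : ∀ j n : ℤ, ∀ x ∈ gr b j, ∀ w ∈ Q n, ⁅x, w⁆ ∈ Q (j + n)) (n : ℤ) :
    grVBar b s ψ n ≤ Q n := by
  rw [grVBar, Submodule.map_le_iff_le_comap, grU, Submodule.span_le]
  rintro _ ⟨l, hl, rfl, rfl⟩
  induction l with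
  | nil => exact h0
  | cons p l ih =>
    simp only [List.map_cons, List.sum_cons, List.prod_cons]
    exact hQ p.1 _ p.2 (hl p (by simp)) _ (ih fun q hq => hl q (by simp [hq]))

theorem iSup_grVBar : ⨆ n, grVBar b s ψ n = ⊤ := by
  rw [eq_top_iff]
  rintro w -
  obtain ⟨u, rfl⟩ := Submodule.Quotient.mk_surjective _ w
  rw [← smul_vBar]
  refine smul_mem_of_ι_smul_mem _ (fun x w hw => ?_) u
    (Submodule.mem_iSup_of_mem 0 (vBar_mem b s ψ))
  exact (gradedSum b (grVBar b s ψ) (lie_mem_grVBar b s ψ)).lie_mem (x := x) hw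

theorem lie_mem_span_vBar (x : VirasoroLike) (hx : x ∈ gr b 0) (w : VBar b s ψ)
    (hw : w ∈ Submodule.span ℂ {vBar b s ψ}) : ⁅x, w⁆ ∈ Submodule.span ℂ {vBar b s ψ} := by
  obtain ⟨a, rfl⟩ := Submodule.mem_span_singleton.mp hw
  have := (isExtremal_vBar b s ψ).eigen ⟨x, hx⟩
  rw [lie_smul, this]
  exact Submodule.smul_mem _ _ (Submodule.smul_mem _ _ (Submodule.mem_span_singleton_self _))

theorem grVBar_le_lowSpan (n : ℤ) :
    grVBar b s ψ n ≤ lowSpan b s (Submodule.span ℂ {vBar b s ψ}) n := by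
  refine grVBar_le (le_lowSpan_zero (Submodule.mem_span_singleton_self _)) ?_ n
  refine lie_mem_lowSpan lie_mem_span_vBar fun j hj x hx w hw => ?_
  obtain ⟨a, rfl⟩ := Submodule.mem_span_singleton.mp hw
  rw [lie_smul, (isExtremal_vBar b s ψ).killed j hj x hx, smul_zero]

theorem grVBar_eq_bot {n : ℤ} (hn : 0 < (s : ℤ) * n) : grVBar b s ψ n = ⊥ :=
  le_bot_iff.mp ((grVBar_le_lowSpan n).trans (lowSpan_eq_bot hn).le)

theorem grVBar_zero_le : grVBar b s ψ 0 ≤ Submodule.span ℂ {vBar b s ψ} :=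
  (grVBar_le_lowSpan 0).trans lowSpan_zero_le

/-- A proper graded submodule misses the line spanned by `v₀`. -/
theorem inf_grVBar_eq_bot {W : Submodule U (VBar b s ψ)} (hW : W ≠ ⊤) {n : ℤ}
    (hn : 0 ≤ (s : ℤ) * n) : W.restrictScalars ℂ ⊓ grVBar b s ψ n = ⊥ := by
  rcases hn.lt_or_eq with hn | hn
  · rw [grVBar_eq_bot hn, inf_bot_eq]
  · obtain rfl : n = 0 := by simpa using hn.symm
    rw [Submodule.eq_bot_iff]
    rintro w ⟨hw, hw0⟩
    obtain ⟨a, rfl⟩ := Submodule.mem_span_singleton.mp (grVBar_zero_le hw0)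
    by_contra hne
    have ha : a ≠ 0 := fun ha => hne (by rw [ha, zero_smul])
    refine hW (eq_top_of_vBar_mem b s ψ ?_)
    have h1 := (W.restrictScalars ℂ).smul_mem a⁻¹ hw
    rw [smul_smul, inv_mul_cancel₀ ha, one_smul] at h1
    exact h1

theorem mem_maxSub_induction {p : VBar b s ψ → Prop} {w : VBar b s ψ} (hw : w ∈ maxSub b s ψ)
    (hW : ∀ W : Submodule U (VBar b s ψ), W ≠ ⊤ →
      IsGradedSubspace (grVBar b s ψ) (W.restrictScalars ℂ) → ∀ w ∈ W, p w) (h0 : p 0)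
    (hadd : ∀ v w, p v → p w → p (v + w)) : p w := by
  rw [maxSub, sSup_eq_iSup'] at hw
  exact Submodule.iSup_induction _ (motive := p) hw (fun W w hw => hW W.1 W.2.1 W.2.2 w hw) h0 hadd

theorem isGradedSubspace_maxSub :
    IsGradedSubspace (grVBar b s ψ) ((maxSub b s ψ).restrictScalars ℂ) := by
  intro w hw
  refine mem_maxSub_induction (p := fun w => w ∈ ⨆ n, (maxSub b s ψ).restrictScalars ℂ ⊓
    grVBar b s ψ n) hw (fun W hW hgr w hw => ?_) (zero_mem _) fun v w => add_mem
  have hle : W ≤ maxSub b s ψ := le_sSup ⟨hW, hgr⟩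
  have hmono : (⨆ n, W.restrictScalars ℂ ⊓ grVBar b s ψ n) ≤
      ⨆ n, (maxSub b s ψ).restrictScalars ℂ ⊓ grVBar b s ψ n :=
    iSup_mono fun n => inf_le_inf_right _ fun w hw => hle hw
  exact hmono (hgr hw)

/-- The part of the induced module in degrees of sign opposite to `s`. -/
def lowVBar (b : Module.Basis (Fin 2) ℤ (ℤ × ℤ)) (s : ℤˣ) (ψ : gr b 0 →ₗ[ℂ] ℂ) :
    Submodule ℂ (VBar b s ψ) := ⨆ (n : ℤ) (_ : (s : ℤ) * n < 0), grVBar b s ψ n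

theorem le_lowVBar {W : Submodule U (VBar b s ψ)} (hW : W ≠ ⊤)
    (hgr : IsGradedSubspace (grVBar b s ψ) (W.restrictScalars ℂ)) :
    W.restrictScalars ℂ ≤ lowVBar b s ψ := by
  refine hgr.trans (iSup_le fun n => ?_)
  rcases le_or_gt 0 ((s : ℤ) * n) with hn | hn
  · rw [inf_grVBar_eq_bot hW hn]
    exact bot_le
  · exact inf_le_right.trans (le_iSup₂_of_le n hn le_rfl)

theorem maxSub_le_lowVBar : (maxSub b s ψ).restrictScalars ℂ ≤ lowVBar b s ψ := fun _ hw =>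
  mem_maxSub_induction (p := fun w => w ∈ lowVBar b s ψ) hw
    (fun _ hW hgr _ hw => le_lowVBar hW hgr hw) (zero_mem _) fun _ _ => add_mem

end Induced

/-! ### The irreducible quotient -/

section Quotient

variable (b : Module.Basis (Fin 2) ℤ (ℤ × ℤ)) (s : ℤˣ) (ψ : gr b 0 →ₗ[ℂ] ℂ)

/-- The projection of the induced module onto its irreducible quotient. -/
def toVHat : VBar b s ψ →ₗ[ℂ] VHat b s ψ := (maxSub b s ψ).mkQ.restrictScalars ℂ

theorem toVHat_surjective : Function.Surjective (toVHat b s ψ) :=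
  Submodule.mkQ_surjective (maxSub b s ψ)

variable {b s ψ}

theorem toVHat_lie (x : VirasoroLike) (w : VBar b s ψ) :
    toVHat b s ψ ⁅x, w⁆ = ⁅x, toVHat b s ψ w⁆ := rfl

theorem toVHat_eq_zero {w : VBar b s ψ} : toVHat b s ψ w = 0 ↔ w ∈ maxSub b s ψ :=
  Submodule.Quotient.mk_eq_zero _

theorem grVHat_eq_map (n : ℤ) : grVHat b s ψ n = (grVBar b s ψ n).map (toVHat b s ψ) := rfl

theorem iSup_grVHat : ⨆ n, grVHat b s ψ n = ⊤ := by
  simp only [grVHat_eq_map]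
  rw [← Submodule.map_iSup, iSup_grVBar, Submodule.map_top, LinearMap.range_eq_top]
  exact toVHat_surjective b s ψ

theorem lie_mem_grVHat (j n : ℤ) (x : VirasoroLike) (hx : x ∈ gr b j) (w : VHat b s ψ)
    (hw : w ∈ grVHat b s ψ n) : ⁅x, w⁆ ∈ grVHat b s ψ (j + n) := by
  obtain ⟨w, hw, rfl⟩ := hw
  exact ⟨⁅x, w⁆, lie_mem_grVBar b s ψ j n x hx w hw, rfl⟩

theorem grVHat_eq_bot {n : ℤ} (hn : 0 < (s : ℤ) * n) : grVHat b s ψ n = ⊥ := by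
  rw [grVHat_eq_map, grVBar_eq_bot hn, Submodule.map_bot]

theorem isExtremal_vHat : IsExtremal b s ψ (toVHat b s ψ (vBar b s ψ)) where
  killed j hj x hx := by
    rw [← toVHat_lie, (isExtremal_vBar b s ψ).killed j hj x hx, map_zero]
  eigen x := by rw [← toVHat_lie, (isExtremal_vBar b s ψ).eigen, map_smul]

theorem vHat_mem : toVHat b s ψ (vBar b s ψ) ∈ grVHat b s ψ 0 :=
  Submodule.mem_map_of_mem (vBar_mem b s ψ)

theorem vHat_ne_zero [Nontrivial (VHat b s ψ)] : toVHat b s ψ (vBar b s ψ) ≠ 0 := by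
  intro h0
  have htop := eq_top_of_vBar_mem b s ψ (toVHat_eq_zero.mp h0)
  obtain ⟨w, hw⟩ := exists_ne (0 : VHat b s ψ)
  obtain ⟨w, rfl⟩ := toVHat_surjective b s ψ w
  exact hw (toVHat_eq_zero.mpr (by rw [htop]; trivial))

theorem isGradedIrreducible_grVHat : IsGradedIrreducible b (grVHat b s ψ) where
  lie_mem := lie_mem_grVHat
  irreducible W hgr := by
    let W' : Submodule U (VBar b s ψ) :=
      { W.toSubmodule.comap (toVHat b s ψ) with
        smul_mem' := fun u w hw => smul_mem_of_ι_smul_mem (W.toSubmodule.comap (toVHat b s ψ))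
          (fun x w hw => W.lie_mem (x := x) hw) u hw }
    have hW' : ∀ w, w ∈ W' ↔ toVHat b s ψ w ∈ W := fun w => Iff.rfl
    have hmax : maxSub b s ψ ≤ W' := fun w hw => by
      rw [hW', toVHat_eq_zero.mpr hw]
      exact zero_mem W
    by_cases htop : W' = ⊤
    · right
      rw [eq_top_iff]
      rintro w -
      obtain ⟨w, rfl⟩ := toVHat_surjective b s ψ w
      rw [← hW', htop]
      trivial
    · left
      have hgr' : IsGradedSubspace (grVBar b s ψ) (W'.restrictScalars ℂ) := by
        intro w hw
        -- lift a decomposition of the image and correct it by an element of `maxSub`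
        have h1 : (⨆ n, W.toSubmodule ⊓ grVHat b s ψ n) ≤
            (⨆ n, W'.restrictScalars ℂ ⊓ grVBar b s ψ n).map (toVHat b s ψ) := by
          rw [Submodule.map_iSup]
          refine iSup_mono fun n => ?_
          rintro _ ⟨hu, ⟨u, hun, rfl⟩⟩
          exact ⟨u, ⟨hu, hun⟩, rfl⟩
        obtain ⟨u, hu, huw⟩ := h1 (hgr hw)
        have h2 : w - u ∈ maxSub b s ψ := by
          rw [← toVHat_eq_zero, map_sub, huw, sub_self]
        have h3 : (⨆ n, (maxSub b s ψ).restrictScalars ℂ ⊓ grVBar b s ψ n) ≤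
            ⨆ n, W'.restrictScalars ℂ ⊓ grVBar b s ψ n :=
          iSup_mono fun n => inf_le_inf_right _ fun w hw => hmax hw
        rw [← sub_add_cancel w u]
        exact add_mem (h3 (isGradedSubspace_maxSub h2)) hu
      have hle : W' ≤ maxSub b s ψ := le_sSup ⟨htop, hgr'⟩
      rw [LieSubmodule.eq_bot_iff]
      intro w hw
      obtain ⟨w, rfl⟩ := toVHat_surjective b s ψ w
      exact toVHat_eq_zero.mpr (hle hw)

end Quotient

/-! ### Recognizing the irreducible quotient -/

section Recognition

theorem eq_of_le_of_iSup_eq_top {V : Type*} [AddCommGroup V] [Module ℂ V]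
    {A B : ℤ → Submodule ℂ V} (hle : ∀ n, A n ≤ B n) (htop : ⨆ n, A n = ⊤) (hB : iSupIndep B)
    (n : ℤ) : A n = B n := by
  refine le_antisymm (hle n) ?_
  have h1 : A n ⊔ ⨆ (m : ℤ) (_ : m ≠ n), A m = ⊤ := by
    rw [eq_top_iff, ← htop]
    refine iSup_le fun m => ?_
    by_cases hm : m = n
    · subst hm; exact le_sup_left
    · exact le_sup_of_le_right (le_iSup₂_of_le m hm le_rfl)
  calc B n = (A n ⊔ ⨆ (m : ℤ) (_ : m ≠ n), A m) ⊓ B n := by rw [h1, top_inf_eq]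
    _ = A n ⊔ (⨆ (m : ℤ) (_ : m ≠ n), A m) ⊓ B n := (sup_inf_assoc_of_le _ (hle n))
    _ ≤ A n ⊔ (⨆ (m : ℤ) (_ : m ≠ n), B m) ⊓ B n :=
      sup_le_sup_left (inf_le_inf_right _ (iSup₂_mono fun m _ => hle m)) _
    _ = A n := by rw [inf_comm, (hB n).eq_bot, sup_bot_eq]

theorem eq_zero_of_sum_eq_zero {V : Type*} [AddCommGroup V] [Module ℂ V]
    {𝒱 : ℤ → Submodule ℂ V} (hI : DirectSum.IsInternal 𝒱) (t : Finset ℤ) (f : ℤ → V) (K : ℤ)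
    (hf : ∀ i, f i ∈ 𝒱 (i + K)) (hsum : ∑ i ∈ t, f i = 0) : ∀ i ∈ t, f i = 0 := by
  classical
  let _ := hI.chooseDecomposition
  intro i hi
  let p : V →ₗ[ℂ] V := (𝒱 (i + K)).subtype ∘ₗ DirectSum.component ℂ ℤ (fun n => 𝒱 n) (i + K) ∘ₗ
    (DirectSum.decomposeLinearEquiv 𝒱 : V →ₗ[ℂ] DirectSum ℤ fun n => 𝒱 n)
  have h1 := congrArg p hsum
  rw [map_sum, map_zero, Finset.sum_eq_single_of_mem i hi] at h1
  · exact (DirectSum.decompose_of_mem_same 𝒱 (hf i)).symm.trans h1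
  · intro j _ hj
    exact DirectSum.decompose_of_mem_ne 𝒱 (hf j) (by omega)

variable {V : Type*} [AddCommGroup V] [Module ℂ V] [LieRingModule VirasoroLike V]
  [LieModule ℂ VirasoroLike V]
variable {b : Module.Basis (Fin 2) ℤ (ℤ × ℤ)} {s : ℤˣ} {ψ : gr b 0 →ₗ[ℂ] ℂ}
  {𝒱 : ℤ → Submodule ℂ V}

/-- Auxiliary form of the recognition theorem, for a module on which `U(L)` acts compatibly. -/
theorem homogeneousIso_of_smul [Module U V] [IsScalarTower ℂ U V]
    (hU : ∀ (x : VirasoroLike) (w : V), ι x • w = ⁅x, w⁆) (hV : InO b 𝒱) {v : V} {K : ℤ}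
    (hv : IsExtremal b s ψ v) (h0 : v ≠ 0) (hK : v ∈ 𝒱 K) : HomogeneousIso b s ψ 𝒱 := by
  let g : VBar b s ψ →ₗ[U] V := (indIdeal b s ψ).liftQ (LinearMap.toSpanSingleton U V v) <| by
    rw [indIdeal, Submodule.span_le]
    rintro _ (⟨x, rfl⟩ | ⟨j, hj, x, hx, rfl⟩)
    · change (ι (x : VirasoroLike) - algebraMap ℂ U (ψ x)) • v = 0
      rw [sub_smul, hU, hv.eigen, algebraMap_smul, sub_self]
    · change ι x • v = 0
      rw [hU, hv.killed j hj x hx]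
  have hgv : g (vBar b s ψ) = v := one_smul U v
  have hglie : ∀ (x : VirasoroLike) (w : VBar b s ψ), g ⁅x, w⁆ = ⁅x, g w⁆ := fun x w => by
    rw [← hU]; exact map_smul g (ι x) w
  let gc : VBar b s ψ →ₗ[ℂ] V := g.restrictScalars ℂ
  have hgdeg : ∀ n, (grVBar b s ψ n).map gc ≤ 𝒱 (n + K) := by
    intro n
    rw [Submodule.map_le_iff_le_comap]
    refine grVBar_le (Q := fun n => (𝒱 (n + K)).comap gc) ?_ ?_ n
    · change g (vBar b s ψ) ∈ 𝒱 (0 + K)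
      rwa [hgv, zero_add]
    · intro j n x hx w hw
      change g ⁅x, w⁆ ∈ 𝒱 (j + n + K)
      rw [hglie, add_assoc]
      exact hV.lie_mem _ _ x hx _ hw
  -- the image of an `L`-stable subspace is a Lie submodule
  let im : Submodule U (VBar b s ψ) → LieSubmodule ℂ VirasoroLike V := fun W =>
    { (W.restrictScalars ℂ).map gc with
      lie_mem := by
        rintro x _ ⟨w, hw, rfl⟩
        exact ⟨⁅x, w⁆, W.smul_mem (ι x) hw, hglie x w⟩ }
  have hsurj : Function.Surjective g := by
    have htop : im ⊤ = ⊤ :=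
      hV.isGradedIrreducible.eq_top _ (v := v) ⟨vBar b s ψ, Submodule.mem_top, hgv⟩ hK h0
    intro w
    have hw : w ∈ im ⊤ := by rw [htop]; trivial
    obtain ⟨w', -, hw'⟩ := hw
    exact ⟨w', hw'⟩
  have hker : maxSub b s ψ = LinearMap.ker g := by
    refine le_antisymm (sSup_le ?_) (le_sSup ⟨?_, ?_⟩)
    · rintro W ⟨hW, hgr⟩
      have hdis : ∀ w ∈ W, g w ∈ ⨆ (m : ℤ) (_ : m ≠ K), 𝒱 m := by
        intro w hw
        have h1 : (lowVBar b s ψ).map gc ≤ ⨆ (m : ℤ) (_ : m ≠ K), 𝒱 m := by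
          simp only [lowVBar, Submodule.map_iSup]
          refine iSup₂_le fun n hn => (hgdeg n).trans (le_iSup₂_of_le (n + K) ?_ le_rfl)
          rintro h
          obtain rfl : n = 0 := by omega
          simp at hn
        exact h1 (Submodule.mem_map_of_mem (le_lowVBar hW hgr hw))
      -- a homogeneous element with nonzero image would generate the whole module
      have hhom : ∀ n, ∀ w ∈ W, w ∈ grVBar b s ψ n → g w = 0 := by
        intro n w hw hwn
        by_contra hne
        have htop := hV.isGradedIrreducible.eq_top (im W) ⟨w, hw, rfl⟩
          (hgdeg n (Submodule.mem_map_of_mem hwn)) hne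
        have hvW : v ∈ im W := by rw [htop]; trivial
        obtain ⟨w', hw', hgw'⟩ := hvW
        have h1 := hdis w' hw'
        change g w' = v at hgw'
        rw [hgw'] at h1
        exact h0 (Submodule.disjoint_def.mp (hV.isInternal.submodule_iSupIndep K) v hK h1)
      have hle : W.restrictScalars ℂ ≤ LinearMap.ker gc :=
        hgr.trans (iSup_le fun n w hw => hhom n w hw.1 hw.2)
      exact fun w hw => hle hw
    · intro htop
      have : vBar b s ψ ∈ LinearMap.ker g := by rw [htop]; trivial
      exact h0 (hgv.symm.trans this)
    · intro w hw
      have hw1 : w ∈ ⨆ n, grVBar b s ψ n := by rw [iSup_grVBar]; trivial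
      obtain ⟨f, hf, rfl⟩ := (Submodule.mem_iSup_iff_exists_finsupp _ _).mp hw1
      have hsum : ∑ i ∈ f.support, g (f i) = 0 := by
        rw [← map_sum]; exact hw
      have hzero := eq_zero_of_sum_eq_zero hV.isInternal f.support (fun i => g (f i)) K
        (fun i => hgdeg i (Submodule.mem_map_of_mem (hf i))) hsum
      exact Submodule.sum_mem _ fun i hi => Submodule.mem_iSup_of_mem i ⟨hzero i hi, hf i⟩
  let eU : VHat b s ψ ≃ₗ[U] V :=
    (Submodule.quotEquivOfEq _ _ hker).trans (g.quotKerEquivOfSurjective hsurj)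
  let eC : V ≃ₗ[ℂ] VHat b s ψ := (eU.restrictScalars ℂ).symm
  let e : V ≃ₗ⁅ℂ, VirasoroLike⁆ VHat b s ψ :=
    { eC with
      map_lie' := by
        intro x w
        change eU.symm ⁅x, w⁆ = ι x • eU.symm w
        rw [← map_smul, hU] }
  refine ⟨e, -K, fun n => ?_⟩
  have hle : ∀ m, (grVHat b s ψ (m - K)).map (eU.restrictScalars ℂ : VHat b s ψ →ₗ[ℂ] V) ≤
      𝒱 m := by
    intro m
    rintro _ ⟨_, ⟨w, hw, rfl⟩, rfl⟩
    have h1 := hgdeg _ (Submodule.mem_map_of_mem (f := gc) hw)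
    rwa [sub_add_cancel] at h1
  have htop : ⨆ m, (grVHat b s ψ (m - K)).map (eU.restrictScalars ℂ : VHat b s ψ →ₗ[ℂ] V) = ⊤ := by
    have h1 : ⨆ m, grVHat b s ψ (m - K) = ⊤ :=
      ((Equiv.subRight K).iSup_comp (g := fun m => grVHat b s ψ m)).trans iSup_grVHat
    rw [← Submodule.map_iSup, h1, Submodule.map_top, LinearMap.range_eq_top]
    exact eU.surjective
  rw [← eq_of_le_of_iSup_eq_top hle htop hV.isInternal.submodule_iSupIndep n, ← sub_eq_add_neg]
  ext w
  constructor
  · rintro ⟨_, ⟨w', hw', rfl⟩, rfl⟩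
    change eU.symm (eU w') ∈ _
    rwa [eU.symm_apply_apply]
  · intro hw
    exact ⟨eU w, ⟨w, hw, rfl⟩, eU.symm_apply_apply w⟩

attribute [local instance 100] LieRing.ofAssociativeRing in
/-- A graded irreducible module with a nonzero homogeneous extremal vector of weight `ψ` is the
module `V̂^±(ψ)`, up to a shift of degrees. -/
theorem InO.homogeneousIso (hV : InO b 𝒱) {v : V} {K : ℤ} (hv : IsExtremal b s ψ v) (h0 : v ≠ 0)
    (hK : v ∈ 𝒱 K) : HomogeneousIso b s ψ 𝒱 := by
  let Φ : U →ₐ[ℂ] Module.End ℂ V :=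
    UniversalEnvelopingAlgebra.lift ℂ (LieModule.toEnd ℂ VirasoroLike V)
  let _ : Module U V := Module.compHom V Φ.toRingHom
  have : IsScalarTower ℂ U V := ⟨fun a u w => by
    change Φ (a • u) w = a • Φ u w
    rw [map_smul]; rfl⟩
  refine homogeneousIso_of_smul (fun x w => ?_) hV hv h0 hK
  change Φ (ι x) w = ⁅x, w⁆
  rw [UniversalEnvelopingAlgebra.lift_ι_apply]
  rfl

end Recognition

/-! ### The induced module is not zero -/

section Nonvanishing

attribute [local instance 100] LieRing.ofAssociativeRing

variable (b : Module.Basis (Fin 2) ℤ (ℤ × ℤ))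

/-- The subalgebra `L_-`, the sum of the `L_j` with `j < 0`. -/
def negPart : LieSubalgebra ℂ VirasoroLike where
  toSubmodule := Submodule.span ℂ {x | ∃ j < 0, x ∈ gr b j}
  lie_mem' := by
    intro x y hx hy
    change x ∈ Submodule.span ℂ {x | ∃ j < 0, x ∈ gr b j} at hx
    change y ∈ Submodule.span ℂ {x | ∃ j < 0, x ∈ gr b j} at hy
    change ⁅x, y⁆ ∈ Submodule.span ℂ {x | ∃ j < 0, x ∈ gr b j}
    induction hx, hy using Submodule.span_induction₂ with
    | mem_mem x y hx hy =>
      obtain ⟨i, hi, hx⟩ := hx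
      obtain ⟨j, hj, hy⟩ := hy
      exact Submodule.subset_span ⟨i + j, by omega, gr_lie b hx hy⟩
    | zero_left y _ => simp
    | zero_right x _ => simp
    | add_left x y z _ _ _ hx hy => rw [add_lie]; exact add_mem hx hy
    | add_right x y z _ _ _ hx hy => rw [lie_add]; exact add_mem hx hy
    | smul_left a x y _ _ h => rw [smul_lie]; exact Submodule.smul_mem _ _ h
    | smul_right a x y _ _ h => rw [lie_smul]; exact Submodule.smul_mem _ _ h

variable {b} in
theorem mem_negPart {j : ℤ} (hj : j < 0) {x : VirasoroLike} (hx : x ∈ gr b j) : x ∈ negPart b :=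
  Submodule.subset_span ⟨j, hj, hx⟩

/-- The enveloping algebra `U(L_-)`. -/
abbrev UNeg : Type := UniversalEnvelopingAlgebra ℂ (negPart b)

/-- The canonical map `L_- → U(L_-)`. -/
abbrev ιNeg : negPart b →ₗ⁅ℂ⁆ UNeg b := UniversalEnvelopingAlgebra.ι ℂ

theorem ιNeg_lie (x y : negPart b) :
    ιNeg b ⁅x, y⁆ = ιNeg b x * ιNeg b y - ιNeg b y * ιNeg b x := by
  rw [LieHom.map_lie, LieRing.of_associative_ring_bracket]

theorem D_mem_gr (r : ℤ × ℤ) : D r ∈ gr b (b.repr r 0) := by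
  have h1 := E_mem b (b.repr r 0) (b.repr r 1)
  rwa [E, ← eq_coords] at h1

theorem cIncl_mem (z : ℂ × ℂ) : cIncl z ∈ gr b 0 := by
  have e : cIncl z = z.1 • h (1, 0) + z.2 • h (0, 1) := by
    rw [h, h, ← map_smul, ← map_smul, ← map_add]; congr 1; ext <;> simp
  rw [e]
  exact add_mem (Submodule.smul_mem _ _ (h_mem_gr_zero b _))
    (Submodule.smul_mem _ _ (h_mem_gr_zero b _))

variable (ψ : gr b 0 →ₗ[ℂ] ℂ)

/-- The central part of an element. -/
def cPart : VirasoroLike →ₗ[ℂ] ℂ × ℂ := LinearMap.snd ℂ ({r : ℤ × ℤ // r ≠ 0} →₀ ℂ) (ℂ × ℂ)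

theorem cPart_D (r : {r : ℤ × ℤ // r ≠ 0}) : cPart (D r.1) = 0 := by rw [D_coe]; rfl

/-- The prescribed action of `L` on the generator `1 ∈ U(L_-)`: it is the inclusion on `L_-`, the
scalar `ψ` on `L_0`, and zero on `L_+`. -/
def initial : VirasoroLike →ₗ[ℂ] UNeg b :=
  (Finsupp.linearCombination ℂ fun r : {r : ℤ × ℤ // r ≠ 0} =>
    if hr : b.repr r.1 0 < 0 then ιNeg b ⟨D r.1, mem_negPart hr (D_mem_gr b r.1)⟩
    else if hr : b.repr r.1 0 = 0 then algebraMap ℂ (UNeg b) (ψ ⟨D r.1, hr ▸ D_mem_gr b r.1⟩)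
    else 0) ∘ₗ dPart +
  Algebra.linearMap ℂ (UNeg b) ∘ₗ ψ ∘ₗ cIncl.codRestrict (gr b 0) (cIncl_mem b) ∘ₗ cPart

theorem initial_D (r : {r : ℤ × ℤ // r ≠ 0}) : initial b ψ (D r.1) =
    if hr : b.repr r.1 0 < 0 then ιNeg b ⟨D r.1, mem_negPart hr (D_mem_gr b r.1)⟩
    else if hr : b.repr r.1 0 = 0 then algebraMap ℂ (UNeg b) (ψ ⟨D r.1, hr ▸ D_mem_gr b r.1⟩)
    else 0 := by
  rw [initial, LinearMap.add_apply, LinearMap.comp_apply, dPart_D,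
    Finsupp.linearCombination_single, one_smul]
  simp only [LinearMap.comp_apply, cPart_D, map_zero, add_zero]

theorem initial_h (r : ℤ × ℤ) : initial b ψ (h r) = algebraMap ℂ (UNeg b) (ψ (h₀ b r)) := by
  rw [initial, LinearMap.add_apply, LinearMap.comp_apply, dPart_h, map_zero, zero_add]
  rfl

theorem repr_coords (j m : ℤ) : b.repr (j • b 0 + m • b 1) 0 = j := by
  simp only [map_add, map_smul, Finsupp.add_apply, Finsupp.smul_apply, b.repr_self]
  simp

theorem initial_of_neg {j : ℤ} (hj : j < 0) {x : VirasoroLike} (hx : x ∈ gr b j) :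
    ∃ hx' : x ∈ negPart b, initial b ψ x = ιNeg b ⟨x, hx'⟩ := by
  refine gr_induction b (p := fun x => ∃ hx' : x ∈ negPart b, initial b ψ x = ιNeg b ⟨x, hx'⟩)
    hx (fun m => ⟨mem_negPart hj (E_mem b j m), ?_⟩) (fun h => absurd h hj.ne) ?_ ?_ ?_
  · have hr : j • b 0 + m • b 1 ≠ 0 := fun h0 => hj.ne (coords_eq_zero b h0).1
    have h1 := initial_D b ψ ⟨_, hr⟩
    rw [dif_pos (by rwa [repr_coords])] at h1
    exact h1
  · exact ⟨zero_mem _, by rw [map_zero]; exact (map_zero (ιNeg b)).symm⟩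
  · rintro x y ⟨hx, hx'⟩ ⟨hy, hy'⟩
    exact ⟨add_mem hx hy, by rw [map_add, hx', hy', ← map_add]; rfl⟩
  · rintro a x ⟨hx, hx'⟩
    exact ⟨(negPart b).smul_mem a hx, by rw [map_smul, hx', ← map_smul]; rfl⟩

theorem initial_of_zero {x : VirasoroLike} (hx : x ∈ gr b 0) :
    initial b ψ x = algebraMap ℂ (UNeg b) (ψ ⟨x, hx⟩) := by
  have key : ∃ hx' : x ∈ gr b 0, initial b ψ x = algebraMap ℂ (UNeg b) (ψ ⟨x, hx'⟩) := by
    refine gr_induction b (p := fun x => ∃ hx' : x ∈ gr b 0,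
      initial b ψ x = algebraMap ℂ (UNeg b) (ψ ⟨x, hx'⟩))
      hx (fun m => ⟨E_mem b 0 m, ?_⟩) (fun _ r => ⟨h_mem_gr_zero b r, initial_h b ψ r⟩) ?_ ?_ ?_
    · by_cases hr : (0 : ℤ) • b 0 + m • b 1 = 0
      · have h1 : E b 0 m = 0 := by rw [E, hr, D_zero]
        have h2 : (⟨E b 0 m, E_mem b 0 m⟩ : gr b 0) = 0 := Subtype.ext h1
        rw [h2, h1, map_zero, map_zero, map_zero]
      · have h1 := initial_D b ψ ⟨_, hr⟩
        rw [dif_neg (by rw [repr_coords]; exact lt_irrefl _), dif_pos (repr_coords b 0 m)] at h1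
        exact h1
    · refine ⟨zero_mem _, ?_⟩
      have h2 : (⟨0, zero_mem _⟩ : gr b 0) = 0 := rfl
      rw [h2, map_zero, map_zero, map_zero]
    · rintro x y ⟨hx, hx'⟩ ⟨hy, hy'⟩
      exact ⟨add_mem hx hy, by rw [map_add, hx', hy', ← map_add, ← map_add]; rfl⟩
    · rintro a x ⟨hx, hx'⟩
      refine ⟨Submodule.smul_mem _ a hx, ?_⟩
      have h2 := map_smul ψ a ⟨x, hx⟩
      change ψ ⟨a • x, _⟩ = _ at h2
      rw [map_smul, hx', h2, smul_eq_mul, map_mul, Algebra.smul_def]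
  exact key.2

theorem initial_of_pos {j : ℤ} (hj : 0 < j) {x : VirasoroLike} (hx : x ∈ gr b j) :
    initial b ψ x = 0 := by
  refine gr_induction b (p := fun x => initial b ψ x = 0) hx (fun m => ?_)
    (fun h => absurd h hj.ne') (map_zero _) (fun x y hx hy => by rw [map_add, hx, hy, add_zero])
    (fun a x hx => by rw [map_smul, hx, smul_zero])
  have hr : j • b 0 + m • b 1 ≠ 0 := fun h0 => hj.ne' (coords_eq_zero b h0).1
  have h1 := initial_D b ψ ⟨_, hr⟩
  rw [dif_neg (by rw [repr_coords]; omega), dif_neg (by rw [repr_coords]; omega)] at h1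
  exact h1

theorem initial_negPart (y : negPart b) : initial b ψ y = ιNeg b y := by
  have key : ∃ hx' : (y : VirasoroLike) ∈ negPart b, initial b ψ y = ιNeg b ⟨y, hx'⟩ := by
    refine Submodule.span_induction (p := fun x _ => ∃ hx' : x ∈ negPart b,
      initial b ψ x = ιNeg b ⟨x, hx'⟩) ?_ ?_ ?_ ?_ y.2
    · rintro x ⟨j, hj, hx⟩
      exact initial_of_neg b ψ hj hx
    · exact ⟨zero_mem _, by rw [map_zero]; exact (map_zero (ιNeg b)).symm⟩
    · rintro x y _ _ ⟨hx, hx'⟩ ⟨hy, hy'⟩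
      exact ⟨add_mem hx hy, by rw [map_add, hx', hy', ← map_add]; rfl⟩
    · rintro a x _ ⟨hx, hx'⟩
      exact ⟨(negPart b).smul_mem a hx, by rw [map_smul, hx', ← map_smul]; rfl⟩
  exact key.2

/-- The action `(y θ)(x) = y θ(x) + θ([x, y])` of `L_-` on the linear maps `L → U(L_-)`. -/
def homAction : negPart b →ₗ⁅ℂ⁆ Module.End ℂ (VirasoroLike →ₗ[ℂ] UNeg b) where
  toFun y :=
    { toFun := fun θ => LinearMap.mulLeft ℂ (ιNeg b y) ∘ₗ θ - θ ∘ₗ bracketL y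
      map_add' := fun θ θ' => by
        rw [LinearMap.comp_add, LinearMap.add_comp]; abel
      map_smul' := fun a θ => by ext x; simp [smul_sub] }
  map_add' y y' := by
    have hcoe : ((y + y' : negPart b) : VirasoroLike) = y + y' := rfl
    ext θ x
    simp only [map_add, LinearMap.coe_mk, AddHom.coe_mk, LinearMap.add_apply, LinearMap.sub_apply,
      LinearMap.comp_apply, LinearMap.mulLeft_apply, hcoe, add_mul]
    abel
  map_smul' a y := by ext θ x; simp [smul_sub]
  map_lie' := by
    intro y y'
    ext θ x
    change ιNeg b ⁅y, y'⁆ * θ x - θ ⁅⁅(y : VirasoroLike), (y' : VirasoroLike)⁆, x⁆ =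
      (ιNeg b y * (ιNeg b y' * θ x - θ ⁅(y' : VirasoroLike), x⁆) -
        (ιNeg b y' * θ ⁅(y : VirasoroLike), x⁆ -
          θ ⁅(y' : VirasoroLike), ⁅(y : VirasoroLike), x⁆⁆)) -
      (ιNeg b y' * (ιNeg b y * θ x - θ ⁅(y : VirasoroLike), x⁆) -
        (ιNeg b y * θ ⁅(y' : VirasoroLike), x⁆ -
          θ ⁅(y : VirasoroLike), ⁅(y' : VirasoroLike), x⁆⁆))
    rw [ιNeg_lie, lie_lie, map_sub]
    noncomm_ring

/-- The action of `L` on `U(L_-)`, as the map `w ↦ (x ↦ x w)`: it is the unique `U(L_-)`-linear map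
into the linear maps `L → U(L_-)` with value `initial` at `1`. -/
def action : UNeg b →ₗ[ℂ] VirasoroLike →ₗ[ℂ] UNeg b :=
  LinearMap.applyₗ (initial b ψ) ∘ₗ
    (UniversalEnvelopingAlgebra.lift ℂ (homAction b)).toLinearMap

theorem action_one : action b ψ 1 = initial b ψ := by
  change UniversalEnvelopingAlgebra.lift ℂ (homAction b) 1 (initial b ψ) = _
  rw [map_one]; rfl

theorem action_mul (y : negPart b) (w : UNeg b) (x : VirasoroLike) :
    action b ψ (ιNeg b y * w) x =
      ιNeg b y * action b ψ w x + action b ψ w ⁅x, (y : VirasoroLike)⁆ := by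
  have h1 : action b ψ (ιNeg b y * w) = homAction b y (action b ψ w) := by
    change UniversalEnvelopingAlgebra.lift ℂ (homAction b) (ιNeg b y * w) (initial b ψ) =
      homAction b y (UniversalEnvelopingAlgebra.lift ℂ (homAction b) w (initial b ψ))
    rw [map_mul, UniversalEnvelopingAlgebra.lift_ι_apply]
    rfl
  rw [h1]
  change ιNeg b y * action b ψ w x - action b ψ w ⁅(y : VirasoroLike), x⁆ = _
  rw [← lie_skew, map_neg, sub_neg_eq_add]

/-- Induction over `U(L_-)`. -/
theorem uNeg_induction (P : Submodule ℂ (UNeg b)) (h1 : 1 ∈ P)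
    (hmul : ∀ (y : negPart b), ∀ w ∈ P, ιNeg b y * w ∈ P) (w : UNeg b) : w ∈ P := by
  have := smul_mem_of_ι_smul_mem P hmul w h1
  rwa [smul_eq_mul, mul_one] at this

theorem action_negPart (y : negPart b) (w : UNeg b) : action b ψ w y = ιNeg b y * w := by
  let P : Submodule ℂ (UNeg b) :=
    { carrier := {w | ∀ y : negPart b, action b ψ w y = ιNeg b y * w}
      zero_mem' := fun y => by simp
      add_mem' := fun {v w} hv hw y => by rw [map_add, LinearMap.add_apply, hv, hw, mul_add]
      smul_mem' := fun a w hw y => by rw [map_smul, LinearMap.smul_apply, hw, mul_smul_comm] }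
  refine uNeg_induction b P (fun y => ?_) (fun y w hw x => ?_) w y
  · rw [action_one, initial_negPart, mul_one]
  · have h1 := hw ⁅x, y⁆
    rw [LieSubalgebra.coe_bracket] at h1
    rw [action_mul, hw, h1, ιNeg_lie]
    noncomm_ring

variable {ψ}

/-- `initial` is compatible with brackets in `L_0 + L_+`. On `L_0`, whose commutators are multiples of
`h(b₂)`, this is the condition `ψ(h(b₂)) = 0`. -/
theorem initial_lie_of_nonneg (hψ : ψ (h₀ b (b 1)) = 0) {i j : ℤ} (hi : 0 ≤ i) (hj : 0 ≤ j)
    {x y : VirasoroLike} (hx : x ∈ gr b i) (hy : y ∈ gr b j) : initial b ψ ⁅x, y⁆ = 0 := by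
  by_cases hij : 0 < i + j
  · exact initial_of_pos b ψ hij (gr_lie b hx hy)
  obtain ⟨rfl, rfl⟩ : i = 0 ∧ j = 0 := by omega
  refine gr_induction b (p := fun x => initial b ψ ⁅x, y⁆ = 0) hx (fun m => ?_)
    (fun _ r => by rw [h_lie, map_zero]) (by simp)
    (fun x x' hx hx' => by rw [add_lie, map_add, hx, hx', add_zero])
    (fun a x hx => by rw [smul_lie, map_smul, hx, smul_zero])
  refine gr_induction b (p := fun y => initial b ψ ⁅E b 0 m, y⁆ = 0) hy (fun n => ?_)
    (fun _ r => by rw [lie_h, map_zero]) (by simp)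
    (fun x x' hx hx' => by rw [lie_add, map_add, hx, hx', add_zero])
    (fun a x hx => by rw [lie_smul, map_smul, hx, smul_zero])
  by_cases hmn : m + n = 0
  · obtain rfl : n = -m := by omega
    have h1 := E_lie_E_neg b 0 m
    rw [neg_zero] at h1
    rw [h1, Int.cast_zero, zero_smul, zero_add, map_smul, initial_h, hψ, map_zero, smul_zero]
  · rw [E_lie_E b (Or.inr hmn)]
    simp

theorem action_one_lie (hψ : ψ (h₀ b (b 1)) = 0) (x y : VirasoroLike) :
    action b ψ (initial b ψ y) x - action b ψ (initial b ψ x) y = initial b ψ ⁅x, y⁆ := by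
  -- for `x ∈ L_-` this is the recursion defining `action`
  have hneg : ∀ (x : negPart b) (y : VirasoroLike),
      action b ψ (initial b ψ y) x - action b ψ (initial b ψ x) y = initial b ψ ⁅(x : VirasoroLike), y⁆ := by
    intro x y
    have h1 := action_mul b ψ x 1 y
    rw [mul_one, action_one] at h1
    rw [action_negPart, initial_negPart, h1, ← lie_skew y, map_neg]
    abel
  have hhom : ∀ i, ∀ x ∈ gr b i, ∀ j, ∀ y ∈ gr b j,
      action b ψ (initial b ψ y) x - action b ψ (initial b ψ x) y = initial b ψ ⁅x, y⁆ := by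
    intro i x hx j y hy
    rcases lt_or_ge i 0 with hi | hi
    · exact hneg ⟨x, mem_negPart hi hx⟩ y
    rcases lt_or_ge j 0 with hj | hj
    · have h1 := hneg ⟨y, mem_negPart hj hy⟩ x
      change _ = initial b ψ ⁅y, x⁆ at h1
      rw [← lie_skew x y, map_neg, ← h1, neg_sub]
    rw [initial_lie_of_nonneg b hψ hi hj hx hy]
    have hsc : ∀ i, 0 ≤ i → ∀ x ∈ gr b i, ∃ c : ℂ, initial b ψ x = c • 1 := by
      intro i hi x hx
      rcases hi.lt_or_eq with hi | rfl
      · exact ⟨0, by rw [initial_of_pos b ψ hi hx, zero_smul]⟩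
      · exact ⟨_, (initial_of_zero b ψ hx).trans (Algebra.algebraMap_eq_smul_one _)⟩
    obtain ⟨c, hc⟩ := hsc i hi x hx
    obtain ⟨c', hc'⟩ := hsc j hj y hy
    rw [hc, hc', map_smul, map_smul, LinearMap.smul_apply, LinearMap.smul_apply, action_one, hc,
      hc', smul_comm, sub_self]
  have hx : ∀ j, ∀ y ∈ gr b j, ∀ x,
      action b ψ (initial b ψ y) x - action b ψ (initial b ψ x) y = initial b ψ ⁅x, y⁆ := by
    intro j y hy x
    refine E_induction b (p := fun x => action b ψ (initial b ψ y) x -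
      action b ψ (initial b ψ x) y = initial b ψ ⁅x, y⁆) x
      (fun i m => hhom i _ (E_mem b i m) j y hy) (hhom 0 _ (h_mem_gr_zero b _) j y hy)
      (hhom 0 _ (h_mem_gr_zero b _) j y hy) (fun x x' hx hx' => ?_) (fun a x hx => ?_)
    · rw [add_lie, map_add, map_add, map_add, map_add, LinearMap.add_apply, ← hx, ← hx']
      abel
    · rw [smul_lie, map_smul, map_smul, map_smul, map_smul, LinearMap.smul_apply, ← hx, smul_sub]
  refine E_induction b (p := fun y => action b ψ (initial b ψ y) x -
      action b ψ (initial b ψ x) y = initial b ψ ⁅x, y⁆) y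
      (fun i m => hx i _ (E_mem b i m) x) (hx 0 _ (h_mem_gr_zero b _) x)
      (hx 0 _ (h_mem_gr_zero b _) x) (fun y y' hy hy' => ?_) (fun a y hy => ?_)
  · rw [lie_add, map_add, map_add, map_add, map_add, LinearMap.add_apply, ← hy, ← hy']
    abel
  · rw [lie_smul, map_smul, map_smul, map_smul, map_smul, LinearMap.smul_apply, ← hy, smul_sub]

/-- `action` is an action of the Lie algebra `L`. -/
theorem action_lie (hψ : ψ (h₀ b (b 1)) = 0) (w : UNeg b) (x y : VirasoroLike) :
    action b ψ w ⁅x, y⁆ = action b ψ (action b ψ w y) x - action b ψ (action b ψ w x) y := by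
  let P : Submodule ℂ (UNeg b) :=
    { carrier := {w | ∀ x y, action b ψ w ⁅x, y⁆ =
        action b ψ (action b ψ w y) x - action b ψ (action b ψ w x) y}
      zero_mem' := fun x y => by simp
      add_mem' := fun {v w} hv hw x y => by
        simp only [map_add, LinearMap.add_apply, hv x y, hw x y]; abel
      smul_mem' := fun a w hw x y => by
        simp only [map_smul, LinearMap.smul_apply, hw x y, smul_sub] }
  refine uNeg_induction b P (fun x y => ?_) (fun z w hw x y => ?_) w x y
  · rw [action_one, action_one_lie b hψ]
  · have h1 := hw x y
    have h2 := hw ⁅x, (z : VirasoroLike)⁆ y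
    have h3 := hw x ⁅y, (z : VirasoroLike)⁆
    have hjac : ⁅⁅x, y⁆, (z : VirasoroLike)⁆ =
        ⁅⁅x, (z : VirasoroLike)⁆, y⁆ + ⁅x, ⁅y, (z : VirasoroLike)⁆⁆ := by
      rw [leibniz_lie x y, lie_lie x y, ← lie_skew ⁅x, (z : VirasoroLike)⁆ y]
      abel
    simp only [action_mul, map_add, LinearMap.add_apply]
    rw [hjac, map_add, h1, h2, h3, mul_sub]
    abel

/-- The representation of `L` on `U(L_-)`. -/
def actionHom (hψ : ψ (h₀ b (b 1)) = 0) : VirasoroLike →ₗ⁅ℂ⁆ Module.End ℂ (UNeg b) :=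
  { (action b ψ).flip with
    map_lie' := by
      intro x y
      ext w
      exact action_lie b hψ w x y }

/-- The generator `v₀` of the induced module is not a combination of vectors of negative degree.
On `U(L_-)` the action of `L_-` is by left multiplication, so that the augmentation of `U(L_-)`
separates `1` from `L_- U(L_-)`. -/
theorem vBar_not_mem_lowVBar (hψ : ψ (h₀ b (b 1)) = 0) : vBar b 1 ψ ∉ lowVBar b 1 ψ := by
  let Φ : U →ₐ[ℂ] Module.End ℂ (UNeg b) := UniversalEnvelopingAlgebra.lift ℂ (actionHom b hψ)
  have hΦ : ∀ (x : VirasoroLike) (w : UNeg b), Φ (ι x) w = action b ψ w x := fun x w => by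
    have : Φ (ι x) = actionHom b hψ x := UniversalEnvelopingAlgebra.lift_ι_apply ℂ _ x
    rw [this]; rfl
  let ε : UNeg b →ₐ[ℂ] ℂ := UniversalEnvelopingAlgebra.lift ℂ (0 : negPart b →ₗ⁅ℂ⁆ ℂ)
  have hε : ∀ y, ε (ιNeg b y) = 0 := fun y => by
    rw [UniversalEnvelopingAlgebra.lift_ι_apply]; rfl
  let F : U →ₗ[ℂ] ℂ := ε.toLinearMap ∘ₗ LinearMap.applyₗ (1 : UNeg b) ∘ₗ Φ.toLinearMap
  have hF : ∀ u, F u = ε (Φ u 1) := fun u => rfl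
  let I : Submodule U U :=
    { carrier := {u | Φ u 1 = 0}
      zero_mem' := by simp
      add_mem' := fun {u v} hu hv => by
        change Φ (u + v) 1 = 0
        rw [map_add, LinearMap.add_apply, hu, hv, add_zero]
      smul_mem' := fun a u hu => by
        change Φ (a * u) 1 = 0
        rw [map_mul, Module.End.mul_apply, hu, map_zero] }
  have hI : indIdeal b 1 ψ ≤ I := by
    rw [indIdeal, Submodule.span_le]
    rintro _ (⟨x, rfl⟩ | ⟨j, hj, x, hx, rfl⟩)
    · change Φ (ι (x : VirasoroLike) - algebraMap ℂ U (ψ x)) 1 = 0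
      rw [map_sub, LinearMap.sub_apply, hΦ, action_one, initial_of_zero b ψ x.2, AlgHom.commutes,
        Module.algebraMap_end_apply, Algebra.algebraMap_eq_smul_one, sub_self]
    · change Φ (ι x) 1 = 0
      rw [hΦ, action_one, initial_of_pos b ψ (by simpa using hj) hx]
  have hlow : lowVBar b 1 ψ ≤
      (LinearMap.ker F).map ((indIdeal b 1 ψ).mkQ.restrictScalars ℂ) := by
    refine iSup₂_le fun n hn => (grVBar_le_lowSpan n).trans (Submodule.span_le.mpr ?_)
    intro w hw
    cases hw with
    | base _ => simp at hn
    | @step n j v x hv hj hx =>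
      obtain ⟨u, rfl⟩ := Submodule.Quotient.mk_surjective _ v
      refine ⟨ι x * u, ?_, rfl⟩
      have hj' : j < 0 := by simpa using hj
      change F (ι x * u) = 0
      have h1 := action_negPart b ψ ⟨x, mem_negPart hj' hx⟩ (Φ u 1)
      rw [hF, map_mul, Module.End.mul_apply, hΦ, h1, map_mul, hε, zero_mul]
  intro hmem
  obtain ⟨u, hu, hu1⟩ := hlow hmem
  have h1 : u - 1 ∈ indIdeal b 1 ψ := (Submodule.Quotient.eq _).mp hu1
  have h2 : F (u - 1) = 0 := by
    have : Φ (u - 1) 1 = 0 := hI h1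
    rw [hF, this, map_zero]
  have h3 : F u = 0 := hu
  rw [map_sub, h3, hF, map_one Φ] at h2
  have h4 : ε ((1 : Module.End ℂ (UNeg b)) 1) = 1 := map_one ε
  rw [h4] at h2
  norm_num at h2

theorem vHat_ne_zero_of_apply_h (hψ : ψ (h₀ b (b 1)) = 0) :
    toVHat b 1 ψ (vBar b 1 ψ) ≠ 0 := fun h0 =>
  vBar_not_mem_lowVBar b hψ (maxSub_le_lowVBar (toVHat_eq_zero.mp h0))

end Nonvanishing

/-! ### The trichotomy -/

section Trichotomy

variable {V : Type*} [AddCommGroup V] [Module ℂ V] [LieRingModule VirasoroLike V]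
  [LieModule ℂ VirasoroLike V]
variable {b : Module.Basis (Fin 2) ℤ (ℤ × ℤ)} {𝒱 : ℤ → Submodule ℂ V}

theorem InO.exists_homogeneousIso (hV : InO b 𝒱) (hub : ¬ UniformlyBounded 𝒱) :
    (∃ ψ : gr b 0 →ₗ[ℂ] ℂ, IsExpPolynomial b ψ ∧ HomogeneousIso b 1 ψ 𝒱) ∨
      ∃ ψ : gr b 0 →ₗ[ℂ] ℂ, IsExpPolynomial b ψ ∧ HomogeneousIso b (-1) ψ 𝒱 := by
  have hnt := hV.exists_lie_ne_zero hub
  rcases hV.bounded_above_or_below hub with hbd | ⟨K, hK⟩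
  · obtain ⟨K, v, ψ, hvK, h0, hv⟩ := hV.exists_isExtremal hbd
    exact Or.inl ⟨ψ, hv.isExpPolynomial hV hnt h0 hvK, hV.homogeneousIso hv h0 hvK⟩
  · obtain ⟨K, v, ψ', hvK, h0, hv⟩ :=
      hV.flip.exists_isExtremal ⟨-K, fun n hn => hK (-n) (by omega)⟩
    obtain ⟨ψ, rfl⟩ := exists_eq_flip ψ'
    exact Or.inr ⟨ψ, isExpPolynomial_flip.mp (hv.isExpPolynomial hV.flip hnt h0 hvK),
      hV.homogeneousIso (isExtremal_flip.mp hv) h0 hvK⟩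

theorem InO.exists_isExtremal_of_equiv (hV : InO b 𝒱) {s : ℤˣ} {ψ : gr b 0 →ₗ[ℂ] ℂ}
    (e : V ≃ₗ⁅ℂ, VirasoroLike⁆ VHat b s ψ) :
    ∃ (K : ℤ) (v : V), v ∈ 𝒱 K ∧ v ≠ 0 ∧ IsExtremal b s ψ v := by
  have := hV.nontrivial
  have : Nontrivial (VHat b s ψ) := e.toLinearEquiv.symm.toEquiv.nontrivial
  let f : VHat b s ψ →ₗ⁅ℂ, VirasoroLike⁆ V := e.symm
  have hf : Function.Injective f := e.symm.injective
  have hext : IsExtremal b s ψ (f (toVHat b s ψ (vBar b s ψ))) := by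
    refine ⟨fun j hj x hx => ?_, fun x => ?_⟩
    · rw [← LieModuleHom.map_lie, isExtremal_vHat.killed j hj x hx, map_zero]
    · rw [← LieModuleHom.map_lie, isExtremal_vHat.eigen, map_smul]
  exact hext.exists_homogeneous hV.toIsGradedModule
    fun h0 => vHat_ne_zero (hf (h0.trans (map_zero f).symm))

/-- A module isomorphic to `V̂⁺(ψ)`, by a not necessarily homogeneous isomorphism, is unbounded and
vanishes in high degrees with respect to its own grading. -/
theorem InO.of_equiv_pos (hV : InO b 𝒱) {ψ : gr b 0 →ₗ[ℂ] ℂ} (hψ : ψ ≠ 0)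
    (e : V ≃ₗ⁅ℂ, VirasoroLike⁆ VHat b 1 ψ) :
    ¬ UniformlyBounded 𝒱 ∧ ∃ K : ℤ, ∀ n, K < n → 𝒱 n = ⊥ := by
  obtain ⟨K, v, hvK, h0, hv⟩ := hV.exists_isExtremal_of_equiv e
  have htop := fun n hn => hV.eq_bot_of_killed (n := n) hvK h0
    (fun j hj => hv.killed j (by simpa using hj)) hn
  exact ⟨hv.not_uniformlyBounded hV.isGradedIrreducible h0 hψ hvK htop, K, htop⟩

/-- The counterpart of `InO.of_equiv_pos` for `V̂⁻(ψ)`, with low degrees. -/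
theorem InO.of_equiv_neg (hV : InO b 𝒱) {ψ : gr b 0 →ₗ[ℂ] ℂ} (hψ : IsExpPolynomial b ψ)
    (e : V ≃ₗ⁅ℂ, VirasoroLike⁆ VHat b (-1) ψ) :
    ¬ UniformlyBounded 𝒱 ∧ ∃ K : ℤ, ∀ n, n < K → 𝒱 n = ⊥ := by
  obtain ⟨K, v, hvK, h0, hv⟩ := hV.exists_isExtremal_of_equiv e
  have hv' := isExtremal_flip.mpr hv
  have hvK' : v ∈ (fun n => 𝒱 (-n)) (-K) := by simpa using hvK
  have htop := fun n hn => hV.flip.eq_bot_of_killed (n := n) hvK' h0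
    (fun j hj => hv'.killed j (by simpa using hj)) hn
  refine ⟨fun hub => hv'.not_uniformlyBounded hV.flip.isGradedIrreducible h0
    (isExpPolynomial_flip.mpr hψ).1 hvK' htop (uniformlyBounded_flip.mpr hub), K, fun n hn => ?_⟩
  simpa using htop (-n) (by omega)

theorem InO.uniformlyBounded_of_bounded (hV : InO b 𝒱) (h1 : ∃ K : ℤ, ∀ n, K < n → 𝒱 n = ⊥)
    (h2 : ∃ K : ℤ, ∀ n, n < K → 𝒱 n = ⊥) : UniformlyBounded 𝒱 := by
  obtain ⟨K, hK⟩ := h1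
  obtain ⟨M, hM⟩ := h2
  refine ⟨∑ n ∈ Finset.Icc M K, Module.finrank ℂ (𝒱 n), fun n => ?_⟩
  have := hV.finite n
  rw [← Module.finrank_eq_rank]
  norm_cast
  by_cases hn : n ∈ Finset.Icc M K
  · exact Finset.single_le_sum (f := fun n => Module.finrank ℂ (𝒱 n)) (fun _ _ => Nat.zero_le _) hn
  · have hbot : 𝒱 n = ⊥ := by
      rw [Finset.mem_Icc, not_and_or, not_le, not_le] at hn
      exact hn.elim (hM n) (hK n)
    rw [hbot, finrank_bot]
    exact Nat.zero_le _

end Trichotomy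

end

end VirasoroLike

theorem theorem3p7 (b : Module.Basis (Fin 2) ℤ (ℤ × ℤ)) :
    -- the trichotomy
    (∀ (V : Type*) [AddCommGroup V] [Module ℂ V] [LieRingModule VirasoroLike V]
        [LieModule ℂ VirasoroLike V] (𝒱 : ℤ → Submodule ℂ V),
      VirasoroLike.InO b 𝒱 →
      -- one of the three cases holds, in (2) and (3) even with a homogeneous isomorphism
      (VirasoroLike.UniformlyBounded 𝒱 ∨
        (∃ ψ : VirasoroLike.gr b 0 →ₗ[ℂ] ℂ, VirasoroLike.IsExpPolynomial b ψ ∧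
          VirasoroLike.HomogeneousIso b 1 ψ 𝒱) ∨
        (∃ ψ : VirasoroLike.gr b 0 →ₗ[ℂ] ℂ, VirasoroLike.IsExpPolynomial b ψ ∧
          VirasoroLike.HomogeneousIso b (-1) ψ 𝒱)) ∧
      -- no two of them hold, even with isomorphisms that need not be homogeneous
      ¬ (VirasoroLike.UniformlyBounded 𝒱 ∧
        ∃ ψ : VirasoroLike.gr b 0 →ₗ[ℂ] ℂ, VirasoroLike.IsExpPolynomial b ψ ∧
          Nonempty (V ≃ₗ⁅ℂ, VirasoroLike⁆ VirasoroLike.VHat b 1 ψ)) ∧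
      ¬ (VirasoroLike.UniformlyBounded 𝒱 ∧
        ∃ ψ : VirasoroLike.gr b 0 →ₗ[ℂ] ℂ, VirasoroLike.IsExpPolynomial b ψ ∧
          Nonempty (V ≃ₗ⁅ℂ, VirasoroLike⁆ VirasoroLike.VHat b (-1) ψ)) ∧
      ¬ ((∃ ψ : VirasoroLike.gr b 0 →ₗ[ℂ] ℂ, VirasoroLike.IsExpPolynomial b ψ ∧
          Nonempty (V ≃ₗ⁅ℂ, VirasoroLike⁆ VirasoroLike.VHat b 1 ψ)) ∧
        ∃ ψ : VirasoroLike.gr b 0 →ₗ[ℂ] ℂ, VirasoroLike.IsExpPolynomial b ψ ∧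
          Nonempty (V ≃ₗ⁅ℂ, VirasoroLike⁆ VirasoroLike.VHat b (-1) ψ))) ∧
    -- the dimension bound for the highest weight modules
    (∀ ψ : VirasoroLike.gr b 0 →ₗ[ℂ] ℂ, VirasoroLike.IsExpPolynomial b ψ →
      (∀ n : ℕ, 1 ≤ n → (n : Cardinal) ≤ Module.rank ℂ (VirasoroLike.grVHat b 1 ψ (-(n : ℤ)))) ∧
      ¬ VirasoroLike.UniformlyBounded (VirasoroLike.grVHat b 1 ψ)) := by
  open VirasoroLike in
  refine ⟨fun V _ _ _ _ 𝒱 hV => ⟨?_, ?_, ?_, ?_⟩, fun ψ hψ => ?_⟩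
  · by_cases hub : UniformlyBounded 𝒱
    · exact Or.inl hub
    · exact Or.inr (hV.exists_homogeneousIso hub)
  · rintro ⟨hub, ψ, hψ, ⟨e⟩⟩
    exact (hV.of_equiv_pos hψ.1 e).1 hub
  · rintro ⟨hub, ψ, hψ, ⟨e⟩⟩
    exact (hV.of_equiv_neg hψ e).1 hub
  · rintro ⟨⟨ψ, hψ, ⟨e⟩⟩, ψ', hψ', ⟨e'⟩⟩
    obtain ⟨hub, habove⟩ := hV.of_equiv_pos hψ.1 e
    exact hub (hV.uniformlyBounded_of_bounded habove (hV.of_equiv_neg hψ' e').2)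
  · have h0 := vHat_ne_zero_of_apply_h b hψ.2.1
    have htop : ∀ n : ℤ, 0 < n → grVHat b 1 ψ n = ⊥ := fun n hn =>
      grVHat_eq_bot (by simpa using hn)
    refine ⟨fun n _ => ?_, isExtremal_vHat.not_uniformlyBounded isGradedIrreducible_grVHat h0
      hψ.1 vHat_mem htop⟩
    have := isExtremal_vHat.le_rank isGradedIrreducible_grVHat h0 hψ.1 vHat_mem htop n
    rwa [add_zero] at this
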